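/- Consider the discontinuous planar piecewise linear near-Hamiltonian system with three zones $$\dot x = H_y(x,y)+\epsilon f(x,y),\qquad \dot y=-H_x(x,y)+\epsilon g(x,y),$$ where $H$, $f$, $g$ equal $H^L,f_L,g_L$ for $x\le -1$, $H^C,f_C,g_C$ for $-1\le x\le 1$, and $H^R,f_R,g_R$ for $x\ge 1$, with $$H^L=\tfrac{b_L}{2}y^2-\tfrac{c_L}{2}x^2+a_Lxy+a_Ly-\beta_Lx,\quad H^C=\tfrac12x^2+\tfrac12y^2,\quad H^R=\tfrac{b_R}{2}y^2-\tfrac{c_R}{2}x^2+a_Rxy-a_Ry-\beta_Rx,$$ $f_i=p_ix+q_iy+r_i$ and $g_i=s_ix+u_iy+v_i$ for $i=L,C,R$, solutions being understood in the sense of Filippov. Take $a_L=b_R=1$, $\beta_L=-3$, $b_L=\beta_R=2$, $c_L=c_R=-1$, $a_R=0$. Then: (1) For $\epsilon=0$ each of the left, central and right subsystems has a real center, i.e. a center lying in the open zone $x<-1$, $-1<x<1$, $x>1$, respectively. (2) For every $h>0$ the closed curve $L_h$ through $(1,h),(1,-h),(-1,-h),(-1,h)$ given by $$\{H^R=H^R(1,h),\,x>1\}\cup\{H^C=H^C(1,-h),\,|x|\le1,\,y<0\}\cup\{H^L=H^L(-1,-h),\,x<-1\}\cup\{H^C=H^C(-1,h),\,|x|\le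 1,\,y>0\}$$ is a periodic orbit of the system with $\epsilon=0$ which visits the three zones and meets the lines $x=\pm1$ only in crossing points (points at which the $x$-components of the two adjacent vector fields have a positive product). (3) At least three limit cycles bifurcate from this family for small $\epsilon>0$: there are real coefficients $p_i,q_i,r_i,s_i,u_i,v_i$ ($i=L,C,R$), three distinct numbers $h_1,h_2,h_3>0$ and $\epsilon_0>0$ such that for every $\epsilon\in(0,\epsilon_0)$ the system has three distinct limit cycles $\Gamma_1(\epsilon),\Gamma_2(\epsilon),\Gamma_3(\epsilon)$, each of which visits the three zones and meets the lines $x=\pm1$ only in crossing points, and $\Gamma_j(\epsilon)\to L_{h_j}$ in the Hausdorff distance as $\epsilon\to0^+$ for $j=1,2,3$. Here a limit cycle is a periodic orbit (the trace of a nonconstant periodic solution) having a neighbourhood that contains no other periodic orbit. -/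

import Mathlib

open Set Filter Topology MeasureTheory

noncomputable section

/-- Coefficients of the quadratic Hamiltonian
`H(x,y) = (b/2) y² - (c/2) x² + a x y + α y - β x`. -/
structure QuadHam where
  a : ℝ
  b : ℝ
  c : ℝ
  α : ℝ
  β : ℝ

namespace QuadHam

/-- The value of the Hamiltonian at `z = (x, y)`. -/
def val (K : QuadHam) (z : ℝ × ℝ) : ℝ :=
  K.b / 2 * z.2 ^ 2 - K.c / 2 * z.1 ^ 2 + K.a * z.1 * z.2 + K.α * z.2 - K.β * z.1

/-- The Hamiltonian vector field `(H_y, -H_x)`; see `hasDerivAt_val_snd`, `hasDerivAt_val_fst`. -/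
def field (K : QuadHam) (z : ℝ × ℝ) : ℝ × ℝ :=
  (K.a * z.1 + K.b * z.2 + K.α, K.c * z.1 - K.a * z.2 + K.β)

theorem hasDerivAt_val_snd (K : QuadHam) (x y : ℝ) :
    HasDerivAt (fun y' => K.val (x, y')) (K.field (x, y)).1 y := by
  have h2 := ((hasDerivAt_id y).pow 2).const_mul (K.b / 2)
  have h3 := (hasDerivAt_id y).const_mul (K.a * x)
  have h4 := (hasDerivAt_id y).const_mul K.α
  have h := (((h2.sub_const (K.c / 2 * x ^ 2)).add h3).add h4).sub_const (K.β * x)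
  refine h.congr_deriv ?_
  simp [field]; ring

theorem hasDerivAt_val_fst (K : QuadHam) (x y : ℝ) :
    HasDerivAt (fun x' => K.val (x', y)) (-(K.field (x, y)).2) x := by
  have h2 := ((hasDerivAt_id x).pow 2).const_mul (K.c / 2)
  have h3 := ((hasDerivAt_id x).const_mul K.a).mul_const y
  have h4 := (hasDerivAt_id x).const_mul K.β
  have h := (((h2.const_sub (K.b / 2 * y ^ 2)).add h3).add_const (K.α * y)).sub h4
  refine h.congr_deriv ?_
  simp [field]; ring

/-- The matrix of the linear part of the Hamiltonian vector field. -/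
def linearPart (K : QuadHam) : Matrix (Fin 2) (Fin 2) ℝ := !![K.a, K.b; K.c, -K.a]

/-- The linear Hamiltonian system has a center lying in the region `S`: an equilibrium in `S`, with
linear part of trace `0` and positive determinant (eigenvalues `± i ω`, `ω > 0`). -/
def HasCenterIn (K : QuadHam) (S : Set (ℝ × ℝ)) : Prop :=
  (∃ z ∈ S, K.field z = 0) ∧ K.linearPart.trace = 0 ∧ 0 < K.linearPart.det

end QuadHam

/-- The affine perturbation `(f, g) = (p x + q y + r, s x + u y + v)` in one zone. -/
structure AffinePert where
  p : ℝ
  q : ℝ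
  r : ℝ
  s : ℝ
  u : ℝ
  v : ℝ

/-- The perturbing vector field `(f, g)`. -/
def AffinePert.field (P : AffinePert) (z : ℝ × ℝ) : ℝ × ℝ :=
  (P.p * z.1 + P.q * z.2 + P.r, P.s * z.1 + P.u * z.2 + P.v)

/-- The open left zone. -/
def zoneL : Set (ℝ × ℝ) := {z | z.1 < -1}

/-- The open central zone. -/
def zoneC : Set (ℝ × ℝ) := {z | -1 < z.1 ∧ z.1 < 1}

/-- The open right zone. -/
def zoneR : Set (ℝ × ℝ) := {z | 1 < z.1}

/-- A planar vector field with three zones separated by the lines `x = -1` and `x = 1`: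
`L` acts for `x ≤ -1`, `C` for `-1 ≤ x ≤ 1`, `R` for `x ≥ 1`. -/
structure ThreeZoneField where
  L : ℝ × ℝ → ℝ × ℝ
  C : ℝ × ℝ → ℝ × ℝ
  R : ℝ × ℝ → ℝ × ℝ

namespace ThreeZoneField

/-- Filippov's set-valued field: single valued in the open zones, and the convex hull of
the two adjacent fields on the lines `x = -1` and `x = 1`. -/
def filippov (X : ThreeZoneField) (z : ℝ × ℝ) : Set (ℝ × ℝ) :=
  if z.1 < -1 then {X.L z}
  else if z.1 = -1 then segment ℝ (X.L z) (X.C z)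
  else if z.1 < 1 then {X.C z}
  else if z.1 = 1 then segment ℝ (X.C z) (X.R z)
  else {X.R z}

/-- Filippov solutions defined for all times: (locally) absolutely continuous curves `γ`, that is,
indefinite integrals of a locally integrable `v`, with velocity in the Filippov field a.e. -/
def IsSolution (X : ThreeZoneField) (γ : ℝ → ℝ × ℝ) : Prop :=
  ∃ v : ℝ → ℝ × ℝ,
    (∀ s t : ℝ, IntervalIntegrable v volume s t) ∧
    (∀ s t : ℝ, γ t = γ s + ∫ τ in s..t, v τ) ∧
    ∀ᵐ t ∂volume, v t ∈ X.filippov (γ t)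

/-- `Γ` is a periodic orbit: the trace of a nonconstant periodic solution. -/
def IsPeriodicOrbit (X : ThreeZoneField) (Γ : Set (ℝ × ℝ)) : Prop :=
  ∃ (γ : ℝ → ℝ × ℝ) (T : ℝ), 0 < T ∧ X.IsSolution γ ∧ Function.Periodic γ T ∧
    (∃ s t : ℝ, γ s ≠ γ t) ∧ Γ = range γ

/-- `Γ` meets the lines `x = ± 1` only in crossing points, where the `x`-components of the two
adjacent fields have a positive product. -/
def IsCrossing (X : ThreeZoneField) (Γ : Set (ℝ × ℝ)) : Prop :=
  ∀ z ∈ Γ, (z.1 = -1 → 0 < (X.L z).1 * (X.C z).1) ∧ (z.1 = 1 → 0 < (X.C z).1 * (X.R z).1)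

/-- A limit cycle: a periodic orbit with a neighbourhood that contains no other periodic orbit. -/
def IsLimitCycle (X : ThreeZoneField) (Γ : Set (ℝ × ℝ)) : Prop :=
  X.IsPeriodicOrbit Γ ∧
    ∃ U : Set (ℝ × ℝ), IsOpen U ∧ Γ ⊆ U ∧ ∀ Γ', X.IsPeriodicOrbit Γ' → Γ' ⊆ U → Γ' = Γ

end ThreeZoneField

/-- `Γ` visits each of the three open zones. -/
def VisitsThreeZones (Γ : Set (ℝ × ℝ)) : Prop :=
  (Γ ∩ zoneL).Nonempty ∧ (Γ ∩ zoneC).Nonempty ∧ (Γ ∩ zoneR).Nonempty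

/-- A piecewise quadratic Hamiltonian: `L` for `x ≤ -1`, `C` for `-1 ≤ x ≤ 1`, `R` for `x ≥ 1`. -/
structure ThreeZoneHam where
  L : QuadHam
  C : QuadHam
  R : QuadHam

/-- The coefficients of a piecewise affine perturbation. -/
structure ThreeZonePert where
  L : AffinePert
  C : AffinePert
  R : AffinePert

namespace ThreeZoneHam

/-- The unperturbed piecewise linear Hamiltonian field. -/
def unperturbed (H : ThreeZoneHam) : ThreeZoneField where
  L := H.L.field
  C := H.C.field
  R := H.R.field

/-- The near-Hamiltonian field `(H_y + ε f, -H_x + ε g)`. -/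
def perturbed (H : ThreeZoneHam) (P : ThreeZonePert) (ε : ℝ) : ThreeZoneField where
  L := fun z => H.L.field z + ε • P.L.field z
  C := fun z => H.C.field z + ε • P.C.field z
  R := fun z => H.R.field z + ε • P.R.field z

/-- The normal form: the central Hamiltonian is `(x² + y²) / 2`, and `α_L = a_L`, `α_R = -a_R`. -/
def normalForm (aL bL cL βL aR bR cR βR : ℝ) : ThreeZoneHam where
  L := { a := aL, b := bL, c := cL, α := aL, β := βL }
  C := { a := 0, b := 1, c := -1, α := 0, β := 0 }
  R := { a := aR, b := bR, c := cR, α := -aR, β := βR }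

/-- The closed curve `L_h` through `A = (1,h)`, `A₁ = (1,-h)`, `A₂ = (-1,-h)`, `A₃ = (-1,h)`,
made of an arc of a level curve of the Hamiltonian of each zone. -/
def annulusCurve (H : ThreeZoneHam) (h : ℝ) : Set (ℝ × ℝ) :=
  {z | H.R.val z = H.R.val (1, h) ∧ 1 < z.1} ∪
  {z | H.C.val z = H.C.val (1, -h) ∧ -1 ≤ z.1 ∧ z.1 ≤ 1 ∧ z.2 < 0} ∪
  {z | H.L.val z = H.L.val (-1, -h) ∧ z.1 < -1} ∪
  {z | H.C.val z = H.C.val (-1, h) ∧ -1 ≤ z.1 ∧ z.1 ≤ 1 ∧ 0 < z.2}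

end ThreeZoneHam

end

/-!
All three unperturbed subsystems are linear centers that turn with angular speed one, around
`(-5, 2)`, `(0, 0)` and `(2, 0)`. The perturbation used here adds to the field of each zone a multiple
`ε κ` of the position vector relative to its center. In a suitable affine chart `(u, w)` every zone
then carries the focus `u' = w + a u`, `w' = -u + a w` (`focusField`), whose flow is explicit, whose
angular speed is still one, and for which `log r + a · angle` is conserved. The charts are chosen so
that each passage through a zone starts at a point `(-1, p)` and ends at `(-1, -q)` (right and left
zone) or at `(1, q)` (central zone), and the conservation law turns into the half-return relation
`FocusStep θ a p q`:
`log (1 + q²) / 2 + a arctan q = log (1 + p²) / 2 - a arctan p + θ a`, with `θ = 2 π` or `θ = π`.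
An orbit through `(1, h)` is therefore described by a chain of four such relations (`OrbitChain`), it
is closed if and only if the last ordinate is `h` again, and for `ε = 0` all orbits close up and form
the annulus (`loopSet_zero_eq_annulusCurve`).

A Filippov solution that meets `x = ± 1` at a crossing point can only continue into the next zone and
follow the arc of the focus there, so that it agrees with the orbit described by the chain
(`OrbitChain.follow`). A periodic solution close to a closed loop is kept away from the segments that
join the foci and from the tangency points, which forces it to run around all three foci and to meet
the half-line `x = 1`, `y > 0` close to the loop (`exists_mem_section`). Since the return map is
increasing, a periodic solution can only meet the half-line in a fixed point. Hence isolated fixed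
points of the return map give limit cycles (`isLimitCycle_of_isolated`).

The displacement of the return map is analytic in `h`, and divided by `ε` it tends pointwise to
`melnikov h` (`tendsto_displacement_div`). Between two points where this function has opposite signs
there is a zero at which it takes both signs arbitrarily closely, again by analyticity. The
displacement then has a zero that converges to it, and the analytic displacement has isolated zeros
only, so no control of derivatives is required (`exists_isolated_zero`). With the factors `-1/5`,
`-39/10` and `1` in the right, central and left zone, `melnikov` is negative at `0`, positive at
`1/2`, negative at `2` and positive near infinity, which gives three branches of limit cycles.
Convergence in the Hausdorff distance is the continuous dependence of the explicit arcs on their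
parameters.
-/

noncomputable section

/-! ### The half-return relation of a focus -/

/-- `log √(1 + y²) + a arctan y`: the sum of `log r` and a multiple of the polar angle that a focus
with linear part `[[a, 1], [-1, a]]` (or its time reversal) conserves, restricted to a line at
distance `1` from the focus and written in the coordinate `y` along that line. -/
def focusLog (a y : ℝ) : ℝ := Real.log (1 + y ^ 2) / 2 + a * Real.arctan y

theorem one_add_sq_pos (y : ℝ) : 0 < 1 + y ^ 2 := by positivity

theorem hasDerivAt_focusLog (a y : ℝ) :
    HasDerivAt (focusLog a) ((y + a) / (1 + y ^ 2)) y := by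
  have h1 : HasDerivAt (fun y : ℝ => 1 + y ^ 2) (2 * y) y := by
    simpa using ((hasDerivAt_id y).pow 2).const_add 1
  have h := ((h1.log (one_add_sq_pos y).ne').div_const 2).add
    ((Real.hasDerivAt_arctan y).const_mul a)
  refine h.congr_deriv ?_
  have := (one_add_sq_pos y).ne'
  field_simp

theorem continuous_focusLog (a : ℝ) : Continuous (focusLog a) :=
  continuous_iff_continuousAt.2 fun y => (hasDerivAt_focusLog a y).continuousAt

theorem strictMonoOn_focusLog (a : ℝ) : StrictMonoOn (focusLog a) (Ici |a|) := by
  refine strictMonoOn_of_deriv_pos (convex_Ici _) (continuous_focusLog a).continuousOn ?_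
  intro y hy
  rw [interior_Ici, mem_Ioi] at hy
  rw [(hasDerivAt_focusLog a y).deriv]
  have := neg_abs_le a
  exact div_pos (by linarith) (one_add_sq_pos y)

theorem analyticAt_focusLog (a y : ℝ) : AnalyticAt ℝ (focusLog a) y := by
  have h1 : AnalyticAt ℝ (fun y : ℝ => Real.log (1 + y ^ 2)) y := by
    have : AnalyticAt ℝ (fun y : ℝ => 1 + y ^ 2) y := by fun_prop
    exact this.log (one_add_sq_pos y)
  have h2 : AnalyticAt ℝ Real.arctan y := Real.contDiff_arctan.contDiffAt.analyticAt
  exact (h1.div_const).add (analyticAt_const.mul h2)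

theorem tendsto_focusLog_atTop (a : ℝ) : Tendsto (focusLog a) atTop atTop := by
  have h1 : Tendsto (fun y : ℝ => Real.log (1 + y ^ 2) / 2) atTop atTop := by
    refine (Real.tendsto_log_atTop.comp ?_).atTop_div_const two_pos
    exact tendsto_atTop_add_const_left _ _ (tendsto_pow_atTop two_ne_zero)
  refine tendsto_atTop_add_right_of_le _ (-(|a| * (Real.pi / 2))) h1 fun y => ?_
  have h2 : |a * Real.arctan y| ≤ |a| * (Real.pi / 2) := by
    rw [abs_mul]
    exact mul_le_mul_of_nonneg_left (abs_le.2 ⟨(Real.neg_pi_div_two_lt_arctan y).le,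
      (Real.arctan_lt_pi_div_two y).le⟩) (abs_nonneg a)
  exact (abs_le.1 h2).1

/-- The relation between the ordinate `p` at which an orbit of the focus `u' = w + a u`,
`w' = -u + a w` leaves the line `u = -1` upwards and the distance `q` to the `u`-axis at its next
intersection with the line `u = -1` (for `θ = 2 π`) or `u = 1` (for `θ = π`). -/
def FocusStep (θ a p q : ℝ) : Prop := focusLog a q = focusLog (-a) p + θ * a

/-- The half-return map of the focus: the solution `q > |a|` of `FocusStep θ a p q`, if there
is one. It is unique, as `focusLog a` is strictly increasing there. -/
def focusMap (θ a p : ℝ) : ℝ :=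
  Function.invFunOn (focusLog a) (Ioi |a|) (focusLog (-a) p + θ * a)

theorem exists_focusLog_eq {a q₀ v : ℝ} (hv : focusLog a q₀ < v) :
    ∃ q ∈ Ioi q₀, focusLog a q = v := by
  obtain ⟨q₁, h1, h2⟩ := ((tendsto_focusLog_atTop a).eventually_gt_atTop v |>.and
    (eventually_gt_atTop q₀)).exists
  obtain ⟨q, hq, e⟩ := intermediate_value_Ioo h2.le (continuous_focusLog a).continuousOn
    (show v ∈ Ioo (focusLog a q₀) (focusLog a q₁) from ⟨hv, h1⟩)
  exact ⟨q, hq.1, e⟩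

theorem focusStep_focusMap {θ a p : ℝ} (h : focusLog a |a| < focusLog (-a) p + θ * a) :
    |a| < focusMap θ a p ∧ FocusStep θ a p (focusMap θ a p) := by
  obtain ⟨q, hq, e⟩ := exists_focusLog_eq h
  exact ⟨Function.invFunOn_mem ⟨q, hq, e⟩, Function.invFunOn_eq ⟨q, hq, e⟩⟩

theorem FocusStep.lt_iff {θ a p q p' q' : ℝ} (hp : |a| ≤ p) (hq : |a| ≤ q) (hp' : |a| ≤ p')
    (hq' : |a| ≤ q') (h : FocusStep θ a p q) (h' : FocusStep θ a p' q') : q < q' ↔ p < p' := by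
  rw [← (strictMonoOn_focusLog a).lt_iff_lt hq hq', h, h', add_lt_add_iff_right]
  have := strictMonoOn_focusLog (-a)
  rw [abs_neg] at this
  exact this.lt_iff_lt hp hp'

theorem analyticAt_focusMap {θ a p : ℝ} (h : focusLog a |a| < focusLog (-a) p + θ * a) :
    AnalyticAt ℝ (focusMap θ a) p := by
  obtain ⟨hq, e⟩ := focusStep_focusMap h
  set q := focusMap θ a p
  have hd : deriv (focusLog a) q ≠ 0 := by
    rw [(hasDerivAt_focusLog a q).deriv]
    have := neg_abs_le a
    exact (div_pos (by linarith) (one_add_sq_pos q)).ne'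
  have hinv : AnalyticAt ℝ (Function.invFunOn (focusLog a) (Ioi |a|)) (focusLog a q) := by
    rw [← analyticAt_comp_iff_of_deriv_ne_zero (analyticAt_focusLog a q) hd]
    refine (analyticAt_id (𝕜 := ℝ) (z := q)).congr ?_
    filter_upwards [Ioi_mem_nhds hq] with y hy
    exact (((strictMonoOn_focusLog a).mono Ioi_subset_Ici_self).injOn.leftInvOn_invFunOn hy).symm
  have hG : AnalyticAt ℝ (fun p => focusLog (-a) p + θ * a) p :=
    (analyticAt_focusLog (-a) p).add analyticAt_const
  rw [e] at hinv
  exact hinv.comp (f := fun p => focusLog (-a) p + θ * a) hG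

theorem abs_arctan_le (y : ℝ) : |Real.arctan y| ≤ 2 :=
  abs_le.2 ⟨by linarith [Real.neg_pi_div_two_lt_arctan y, Real.pi_lt_four],
    by linarith [Real.arctan_lt_pi_div_two y, Real.pi_lt_four]⟩

theorem abs_focusLog_sub_le (a y : ℝ) : |focusLog a y - focusLog 0 y| ≤ 2 * |a| := by
  have : focusLog a y - focusLog 0 y = a * Real.arctan y := by simp [focusLog]
  rw [this, abs_mul, mul_comm 2]
  exact mul_le_mul_of_nonneg_left (abs_arctan_le y) (abs_nonneg a)

/-- For a weak focus the half-return map is close to the identity, so that it is defined on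
`(α, ∞)` with values in `(α', ∞)`, whenever `0 < α' < α`. -/
theorem eventually_focusMap (θ : ℝ) {α α' : ℝ} (h0 : 0 < α') (hα : α' < α) :
    ∀ᶠ a in 𝓝 (0 : ℝ), |a| < α' ∧ ∀ p, α < p → α' < focusMap θ a p ∧
      FocusStep θ a p (focusMap θ a p) ∧ AnalyticAt ℝ (focusMap θ a) p := by
  have hF : focusLog 0 α' < focusLog 0 α := strictMonoOn_focusLog 0
    (by simpa using h0.le) (by simpa using (h0.trans hα).le) hα
  have hc : Tendsto (fun a : ℝ => 4 * |a| + |θ * a|) (𝓝 0) (𝓝 0) := by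
    have : Continuous (fun a : ℝ => 4 * |a| + |θ * a|) := by fun_prop
    simpa using this.tendsto 0
  have hab : Tendsto (fun a : ℝ => |a|) (𝓝 0) (𝓝 0) := by
    simpa using (continuous_abs (G := ℝ)).tendsto 0
  filter_upwards [hab.eventually_lt_const h0, hc.eventually_lt_const (sub_pos.2 hF)]
    with a ha1 ha2
  refine ⟨ha1, fun p hp => ?_⟩
  have hFp : focusLog 0 α < focusLog 0 p := strictMonoOn_focusLog 0
    (by simpa using (h0.trans hα).le) (by simpa using (h0.trans (hα.trans hp)).le) hp
  have e1 := abs_le.1 (abs_focusLog_sub_le a α')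
  have e2 := abs_le.1 (abs_focusLog_sub_le (-a) p)
  rw [abs_neg] at e2
  have e3 := neg_abs_le (θ * a)
  have key : focusLog a α' < focusLog (-a) p + θ * a := by linarith [e1.2, e2.1]
  have key' : focusLog a |a| < focusLog (-a) p + θ * a :=
    (strictMonoOn_focusLog a self_mem_Ici ha1.le ha1).trans key
  obtain ⟨hq, e⟩ := focusStep_focusMap key'
  refine ⟨?_, e, analyticAt_focusMap key'⟩
  rw [← (strictMonoOn_focusLog a).lt_iff_lt ha1.le hq.le, e]
  exact key

/-- For a focus that tends to a center the two ordinates related by `FocusStep` merge. -/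
theorem tendsto_of_focusStep {ι : Type*} {l : Filter ι} {θ h : ℝ} {a p q : ι → ℝ} (hh : 0 < h)
    (ha : Tendsto a l (𝓝 0)) (hp : Tendsto p l (𝓝 h)) (hq : ∀ᶠ i in l, 0 < q i)
    (hs : ∀ᶠ i in l, FocusStep θ (a i) (p i) (q i)) : Tendsto q l (𝓝 h) := by
  have hb : ∀ y : ι → ℝ, Tendsto (fun i => a i * Real.arctan (y i)) l (𝓝 0) := fun y =>
    ha.zero_mul_isBoundedUnder_le ⟨2, by
      simpa using Eventually.of_forall fun i => abs_arctan_le (y i)⟩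
  have h1 : Tendsto (fun i => Real.log (1 + p i ^ 2) - 2 * (a i * Real.arctan (p i))
      - 2 * (a i * Real.arctan (q i)) + 2 * (θ * a i)) l (𝓝 (Real.log (1 + h ^ 2))) := by
    have := ((((hp.pow 2).const_add 1).log (one_add_sq_pos h).ne').sub
      ((hb p).const_mul 2)).sub ((hb q).const_mul 2) |>.add ((ha.const_mul θ).const_mul 2)
    simpa using this
  have h2 := ((Real.continuous_exp.tendsto _).comp h1).sub_const 1 |>.sqrt
  rw [Real.exp_log (one_add_sq_pos h), add_sub_cancel_left, Real.sqrt_sq hh.le] at h2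
  refine h2.congr' ?_
  filter_upwards [hq, hs] with i hqi hsi
  have : Real.log (1 + p i ^ 2) - 2 * (a i * Real.arctan (p i))
      - 2 * (a i * Real.arctan (q i)) + 2 * (θ * a i) = Real.log (1 + q i ^ 2) := by
    simp only [FocusStep, focusLog] at hsi; linarith
  simp only [Function.comp_apply, this]
  rw [Real.exp_log (one_add_sq_pos _), add_sub_cancel_left, Real.sqrt_sq hqi.le]

/-! ### Arcs of a focus -/

theorem HasDerivAt.fst {f : ℝ → ℝ × ℝ} {f' : ℝ × ℝ} {t : ℝ} (h : HasDerivAt f f' t) :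
    HasDerivAt (fun t => (f t).1) f'.1 t := by
  simpa using h.hasFDerivAt.fst.hasDerivAt

theorem HasDerivAt.snd {f : ℝ → ℝ × ℝ} {f' : ℝ × ℝ} {t : ℝ} (h : HasDerivAt f f' t) :
    HasDerivAt (fun t => (f t).2) f'.2 t := by
  simpa using h.hasFDerivAt.snd.hasDerivAt

/-- The linear field with a focus (a center for `a = 0`) at the origin and angular speed `1`. -/
def focusField (a : ℝ) (q : ℝ × ℝ) : ℝ × ℝ := (q.2 + a * q.1, -q.1 + a * q.2)

/-- The flow of `focusField a`. -/
def focusFlow (a t : ℝ) (q : ℝ × ℝ) : ℝ × ℝ :=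
  (Real.exp (a * t) * (q.1 * Real.cos t + q.2 * Real.sin t),
    Real.exp (a * t) * (q.2 * Real.cos t - q.1 * Real.sin t))

theorem focusFlow_zero (a : ℝ) (q : ℝ × ℝ) : focusFlow a 0 q = q := by simp [focusFlow]

theorem hasDerivAt_focusFlow (a t : ℝ) (q : ℝ × ℝ) :
    HasDerivAt (fun t => focusFlow a t q) (focusField a (focusFlow a t q)) t := by
  have he : HasDerivAt (fun t => Real.exp (a * t)) (Real.exp (a * t) * a) t := by
    simpa using ((hasDerivAt_id t).const_mul a).exp
  have h1 := he.mul (((Real.hasDerivAt_cos t).const_mul q.1).add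
    ((Real.hasDerivAt_sin t).const_mul q.2))
  have h2 := he.mul (((Real.hasDerivAt_cos t).const_mul q.2).sub
    ((Real.hasDerivAt_sin t).const_mul q.1))
  refine (h1.prodMk h2).congr_deriv ?_
  simp only [focusField, focusFlow, Prod.mk.injEq, Pi.add_apply, Pi.sub_apply]
  constructor <;> ring

theorem continuous_focusFlow (a : ℝ) (q : ℝ × ℝ) : Continuous (fun t => focusFlow a t q) :=
  continuous_iff_continuousAt.2 fun t => (hasDerivAt_focusFlow a t q).continuousAt

theorem focusFlow_add_pi (a t : ℝ) (q : ℝ × ℝ) :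
    focusFlow a (t + Real.pi) q = (-Real.exp (a * Real.pi)) • focusFlow a t q := by
  simp only [focusFlow, mul_add, Real.exp_add, Real.cos_add_pi, Real.sin_add_pi, Prod.smul_mk,
    smul_eq_mul, Prod.mk.injEq]
  constructor <;> ring

/-- A curve with velocity `focusField a` follows the flow. -/
theorem eq_focusFlow_of_hasDerivAt {a s t : ℝ} {q : ℝ → ℝ × ℝ} (hc : ContinuousOn q (Icc s t))
    (hd : ∀ τ ∈ Ioo s t, HasDerivAt q (focusField a (q τ)) τ) :
    ∀ τ ∈ Icc s t, q τ = focusFlow a (τ - s) (q s) := by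
  intro τ hτ
  -- the flow of `-a` with reversed rotation turns `q` into a constant curve
  let k : ℝ → ℝ × ℝ := fun τ =>
    (Real.exp (-a * (τ - s)) * ((q τ).1 * Real.cos (τ - s) - (q τ).2 * Real.sin (τ - s)),
      Real.exp (-a * (τ - s)) * ((q τ).2 * Real.cos (τ - s) + (q τ).1 * Real.sin (τ - s)))
  have hkc : ContinuousOn k (Icc s t) := by
    have h1 := hc.fst
    have h2 := hc.snd
    fun_prop
  have hkd : ∀ r ∈ Ioo s t, HasDerivAt k 0 r := by
    intro r hr
    have hq := hd r hr
    have h1 : HasDerivAt (fun r => (q r).1) (focusField a (q r)).1 r :=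
      hq.fst
    have h2 : HasDerivAt (fun r => (q r).2) (focusField a (q r)).2 r :=
      hq.snd
    have hs : HasDerivAt (fun r => r - s) 1 r := (hasDerivAt_id r).sub_const s
    have he : HasDerivAt (fun r => Real.exp (-a * (r - s))) (Real.exp (-a * (r - s)) * -a) r := by
      simpa using (hs.const_mul (-a)).exp
    have h3 := he.mul ((h1.mul hs.cos).sub (h2.mul hs.sin))
    have h4 := he.mul ((h2.mul hs.cos).add (h1.mul hs.sin))
    refine (h3.prodMk h4).congr_deriv ?_
    simp only [focusField, Prod.mk_eq_zero, Pi.add_apply, Pi.sub_apply, Pi.mul_apply]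
    constructor <;> ring
  have hk : k τ = k s := by
    rcases hτ.1.eq_or_lt with rfl | hlt
    · rfl
    by_contra hne
    obtain ⟨c, hcm, hce⟩ := exists_hasDerivAt_eq_slope (fun r => (k r).1) (fun _ => 0) hlt
      ((hkc.mono (Icc_subset_Icc_right hτ.2)).fst) (fun r hr =>
        (hkd r ⟨hr.1, hr.2.trans_le hτ.2⟩).fst)
    obtain ⟨c', hcm', hce'⟩ := exists_hasDerivAt_eq_slope (fun r => (k r).2) (fun _ => 0) hlt
      ((hkc.mono (Icc_subset_Icc_right hτ.2)).snd) (fun r hr =>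
        (hkd r ⟨hr.1, hr.2.trans_le hτ.2⟩).snd)
    have hpos : τ - s ≠ 0 := (sub_pos.2 hlt).ne'
    rw [eq_comm, div_eq_zero_iff, or_iff_left hpos, sub_eq_zero] at hce hce'
    exact hne (Prod.ext hce hce')
  have e1 := congrArg Prod.fst hk
  have e2 := congrArg Prod.snd hk
  simp only [k, sub_self, mul_zero, Real.exp_zero, Real.cos_zero, Real.sin_zero, mul_one, one_mul,
    sub_zero, add_zero] at e1 e2
  have hexp : Real.exp (a * (τ - s)) * Real.exp (-a * (τ - s)) = 1 := by
    rw [← Real.exp_add]; simp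
  have hcs := Real.sin_sq_add_cos_sq (τ - s)
  ext
  · simp only [focusFlow]
    rw [← e1, ← e2]
    linear_combination (-(q τ).1 * (Real.sin (τ - s) ^ 2 + Real.cos (τ - s) ^ 2)) * hexp
      - (q τ).1 * hcs
  · simp only [focusFlow]
    rw [← e1, ← e2]
    linear_combination (-(q τ).2 * (Real.sin (τ - s) ^ 2 + Real.cos (τ - s) ^ 2)) * hexp
      - (q τ).2 * hcs

/-- The time an orbit of the focus needs from `(-1, p)` to its next point `(-1, -q)` on the same
line (`θ = 2 π`) or its next point `(1, q)` on the opposite line (`θ = π`). -/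
def arcTime (θ p q : ℝ) : ℝ := θ - Real.arctan p - Real.arctan q

theorem sqrt_one_add_sq (y : ℝ) : √(1 + y ^ 2) = Real.exp (Real.log (1 + y ^ 2) / 2) := by
  rw [Real.sqrt_eq_rpow, Real.rpow_def_of_pos (one_add_sq_pos y)]
  congr 1; ring

theorem focusFlow_eq_polar (a t p : ℝ) : focusFlow a t (-1, p) =
    (-(Real.exp (a * t + Real.log (1 + p ^ 2) / 2) * Real.cos (t + Real.arctan p)),
      Real.exp (a * t + Real.log (1 + p ^ 2) / 2) * Real.sin (t + Real.arctan p)) := by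
  have h : √(1 + p ^ 2) ≠ 0 := (Real.sqrt_pos.2 (one_add_sq_pos p)).ne'
  simp only [focusFlow, Real.cos_add, Real.sin_add, Real.cos_arctan, Real.sin_arctan,
    Real.exp_add, ← sqrt_one_add_sq, Prod.mk.injEq]
  constructor
  · field_simp; ring
  · field_simp; ring

theorem cos_eq_exp {χ : ℝ} (h1 : -(Real.pi / 2) < χ) (h2 : χ < Real.pi / 2) :
    Real.cos χ = Real.exp (-(Real.log (1 + Real.tan χ ^ 2) / 2)) := by
  rw [Real.exp_neg, ← sqrt_one_add_sq, ← one_div, ← Real.cos_arctan, Real.arctan_tan h1 h2]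

/-- An orbit that leaves the line `u = -1` upwards does not come back before the angle `π / 2`. -/
theorem exp_mul_cos_lt_one_of_start {a p t : ℝ} (hp : |a| ≤ p) (h0 : 0 < t)
    (ht : t + Real.arctan p < Real.pi / 2) :
    Real.exp (a * t + Real.log (1 + p ^ 2) / 2) * Real.cos (t + Real.arctan p) < 1 := by
  have h1 : -(Real.pi / 2) < t + Real.arctan p := by
    linarith [Real.neg_pi_div_two_lt_arctan p]
  rw [cos_eq_exp h1 ht, ← Real.exp_add, Real.exp_lt_one_iff]
  have hlt : p < Real.tan (t + Real.arctan p) := by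
    rw [← Real.arctan_lt_arctan_iff, Real.arctan_tan h1 ht]; linarith
  have h2 := strictMonoOn_focusLog (-a) (by simpa using hp) (by simpa using hp.trans hlt.le) hlt
  simp only [focusLog, Real.arctan_tan h1 ht] at h2
  linarith

/-- The time reversal of `exp_mul_cos_lt_one_of_start`, at the end of an arc. -/
theorem exp_mul_cos_lt_one_of_end {θ a p q t χ : ℝ} (hs : FocusStep θ a p q) (hq : |a| ≤ q)
    (hχ : χ = θ - Real.arctan p - t) (h0 : Real.arctan q < χ) (h2 : χ < Real.pi / 2) :
    Real.exp (a * t + Real.log (1 + p ^ 2) / 2) * Real.cos χ < 1 := by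
  have h1 : -(Real.pi / 2) < χ := (Real.neg_pi_div_two_lt_arctan q).trans h0
  rw [cos_eq_exp h1 h2, ← Real.exp_add, Real.exp_lt_one_iff]
  have hlt : q < Real.tan χ := by
    rw [← Real.arctan_lt_arctan_iff, Real.arctan_tan h1 h2]; exact h0
  have h3 := strictMonoOn_focusLog a hq (hq.trans hlt.le) hlt
  simp only [FocusStep, focusLog, Real.arctan_tan h1 h2] at h3 hs
  have : t = θ - Real.arctan p - χ := by linarith
  rw [this]
  linarith

theorem exp_arcTime {θ a p q : ℝ} (hs : FocusStep θ a p q) :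
    Real.exp (a * arcTime θ p q + Real.log (1 + p ^ 2) / 2) = √(1 + q ^ 2) := by
  rw [sqrt_one_add_sq]
  congr 1
  simp only [FocusStep, focusLog, arcTime] at hs ⊢
  linarith

theorem focusFlow_long_end {a p q : ℝ} (hs : FocusStep (2 * Real.pi) a p q) :
    focusFlow a (arcTime (2 * Real.pi) p q) (-1, p) = (-1, -q) := by
  have h : √(1 + q ^ 2) ≠ 0 := (Real.sqrt_pos.2 (one_add_sq_pos q)).ne'
  rw [focusFlow_eq_polar, exp_arcTime hs]
  have : arcTime (2 * Real.pi) p q + Real.arctan p = 2 * Real.pi - Real.arctan q := by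
    simp only [arcTime]; ring
  rw [this, Real.cos_two_pi_sub, Real.sin_two_pi_sub, Real.cos_arctan, Real.sin_arctan]
  ext <;> field_simp

theorem focusFlow_short_end {a p q : ℝ} (hs : FocusStep Real.pi a p q) :
    focusFlow a (arcTime Real.pi p q) (-1, p) = (1, q) := by
  have h : √(1 + q ^ 2) ≠ 0 := (Real.sqrt_pos.2 (one_add_sq_pos q)).ne'
  rw [focusFlow_eq_polar, exp_arcTime hs]
  have : arcTime Real.pi p q + Real.arctan p = Real.pi - Real.arctan q := by
    simp only [arcTime]; ring
  rw [this, Real.cos_pi_sub, Real.sin_pi_sub, Real.cos_arctan, Real.sin_arctan]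
  ext <;> field_simp

theorem pi_lt_arcTime_long (p q : ℝ) : Real.pi < arcTime (2 * Real.pi) p q := by
  have := Real.arctan_lt_pi_div_two p
  have := Real.arctan_lt_pi_div_two q
  simp only [arcTime]; linarith

theorem arcTime_short_pos (p q : ℝ) : 0 < arcTime Real.pi p q := by
  have := Real.arctan_lt_pi_div_two p
  have := Real.arctan_lt_pi_div_two q
  simp only [arcTime]; linarith

/-- A long arc lies to the right of the line `u = -1`, and it surrounds the focus. -/
theorem focusFlow_long_mem {a p q t : ℝ} (hs : FocusStep (2 * Real.pi) a p q) (hp : |a| ≤ p)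
    (hq : |a| ≤ q) (h0 : 0 < t) (ht : t < arcTime (2 * Real.pi) p q) :
    -1 < (focusFlow a t (-1, p)).1 ∧
      ((focusFlow a t (-1, p)).2 = 0 → 0 < (focusFlow a t (-1, p)).1) := by
  have hp0 : 0 ≤ Real.arctan p := Real.arctan_nonneg.2 ((abs_nonneg a).trans hp)
  have hq0 : 0 ≤ Real.arctan q := Real.arctan_nonneg.2 ((abs_nonneg a).trans hq)
  rw [focusFlow_eq_polar]
  have hpi := Real.pi_pos
  have hr := Real.exp_pos (a * t + Real.log (1 + p ^ 2) / 2)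
  simp only [arcTime] at ht
  dsimp only
  constructor
  · rw [neg_lt_neg_iff]
    rcases lt_or_ge (t + Real.arctan p) (Real.pi / 2) with h1 | h1
    · exact exp_mul_cos_lt_one_of_start hp h0 h1
    rcases le_or_gt (t + Real.arctan p) (3 * Real.pi / 2) with h2 | h2
    · have : Real.cos (t + Real.arctan p) ≤ 0 :=
        Real.cos_nonpos_of_pi_div_two_le_of_le h1 (by linarith)
      nlinarith
    · rw [← Real.cos_two_pi_sub]
      exact exp_mul_cos_lt_one_of_end hs hq (by ring) (by linarith) (by linarith)
  · intro hw
    have hsin := (mul_eq_zero.1 hw).resolve_left hr.ne'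
    rw [neg_pos]
    refine mul_neg_of_pos_of_neg hr ?_
    have : t + Real.arctan p = Real.pi := by
      rcases lt_trichotomy (t + Real.arctan p) Real.pi with h | h | h
      · exact absurd hsin (Real.sin_pos_of_pos_of_lt_pi (by linarith) h).ne'
      · exact h
      · have := Real.sin_pos_of_pos_of_lt_pi (x := t + Real.arctan p - Real.pi) (by linarith)
          (by linarith)
        rw [Real.sin_sub_pi] at this
        linarith
    rw [this, Real.cos_pi]; norm_num

/-- A short arc lies in the upper half of the strip `|u| < 1`. -/
theorem focusFlow_short_mem {a p q t : ℝ} (hs : FocusStep Real.pi a p q) (hp : |a| ≤ p)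
    (hq : |a| ≤ q) (h0 : 0 < t) (ht : t < arcTime Real.pi p q) :
    -1 < (focusFlow a t (-1, p)).1 ∧ (focusFlow a t (-1, p)).1 < 1 ∧
      0 < (focusFlow a t (-1, p)).2 := by
  have hp0 : 0 ≤ Real.arctan p := Real.arctan_nonneg.2 ((abs_nonneg a).trans hp)
  have hq0 : 0 ≤ Real.arctan q := Real.arctan_nonneg.2 ((abs_nonneg a).trans hq)
  rw [focusFlow_eq_polar]
  have hpi := Real.pi_pos
  have hr := Real.exp_pos (a * t + Real.log (1 + p ^ 2) / 2)
  simp only [arcTime] at ht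
  dsimp only
  refine ⟨?_, ?_, mul_pos hr (Real.sin_pos_of_pos_of_lt_pi (by linarith) (by linarith))⟩
  · rw [neg_lt_neg_iff]
    rcases lt_or_ge (t + Real.arctan p) (Real.pi / 2) with h1 | h1
    · exact exp_mul_cos_lt_one_of_start hp h0 h1
    · have : Real.cos (t + Real.arctan p) ≤ 0 :=
        Real.cos_nonpos_of_pi_div_two_le_of_le h1 (by linarith)
      nlinarith
  · rw [← mul_neg, ← Real.cos_pi_sub]
    rcases le_or_gt (t + Real.arctan p) (Real.pi / 2) with h1 | h1
    · have : 0 ≤ Real.cos (t + Real.arctan p) :=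
        Real.cos_nonneg_of_neg_pi_div_two_le_of_le (by linarith) h1
      rw [Real.cos_pi_sub]
      nlinarith
    · exact exp_mul_cos_lt_one_of_end hs hq (by ring) (by linarith) (by linarith)

theorem exists_polar {u w p : ℝ} (h : u ^ 2 + w ^ 2 = 1 + p ^ 2) :
    ∃ ψ, 0 ≤ ψ ∧ ψ < 2 * Real.pi ∧ (u, w) = focusFlow 0 (ψ - Real.arctan p) (-1, p) := by
  have hr : 0 < √(1 + p ^ 2) := Real.sqrt_pos.2 (one_add_sq_pos p)
  have hr2 : √(1 + p ^ 2) ^ 2 = 1 + p ^ 2 := Real.sq_sqrt (one_add_sq_pos p).le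
  let z : ℂ := ⟨-u, w⟩
  have hz : ‖z‖ = √(1 + p ^ 2) := by
    rw [Complex.norm_def, Complex.normSq_mk]; congr 1; linarith
  have key : ∀ ψ : ℝ, Real.cos ψ = Real.cos z.arg → Real.sin ψ = Real.sin z.arg →
      (u, w) = focusFlow 0 (ψ - Real.arctan p) (-1, p) := by
    intro ψ h1 h2
    rw [focusFlow_eq_polar, zero_mul, zero_add, ← sqrt_one_add_sq, ← hz, sub_add_cancel, h1, h2,
      Complex.norm_mul_cos_arg, Complex.norm_mul_sin_arg]
    simp [z]
  rcases le_or_gt 0 z.arg with h0 | h0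
  · exact ⟨z.arg, h0, by linarith [Complex.arg_le_pi z, Real.pi_pos], key _ rfl rfl⟩
  · exact ⟨z.arg + 2 * Real.pi, by linarith [Complex.neg_pi_lt_arg z, Real.pi_pos], by linarith,
      key _ (Real.cos_add_two_pi _) (Real.sin_add_two_pi _)⟩

theorem focusFlow_zero_normSq (t : ℝ) (q : ℝ × ℝ) :
    (focusFlow 0 t q).1 ^ 2 + (focusFlow 0 t q).2 ^ 2 = q.1 ^ 2 + q.2 ^ 2 := by
  simp only [focusFlow, zero_mul, Real.exp_zero, one_mul]
  linear_combination (q.1 ^ 2 + q.2 ^ 2) * Real.sin_sq_add_cos_sq t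

theorem focusStep_zero (θ p : ℝ) : FocusStep θ 0 p p := by simp [FocusStep]

theorem long_circle {p : ℝ} (hp : 0 < p) : {z : ℝ × ℝ | z.1 ^ 2 + z.2 ^ 2 = 1 + p ^ 2 ∧ -1 < z.1} =
    (fun t => focusFlow 0 t (-1, p)) '' Ioo 0 (arcTime (2 * Real.pi) p p) := by
  ext ⟨u, w⟩
  constructor
  · rintro ⟨h1, h2⟩
    obtain ⟨ψ, h3, h4, e⟩ := exists_polar h1
    refine ⟨_, ⟨?_, ?_⟩, e.symm⟩
    all_goals
      have hr : 0 < √(1 + p ^ 2) := Real.sqrt_pos.2 (one_add_sq_pos p)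
      have hu := congrArg Prod.fst e
      rw [focusFlow_eq_polar, sub_add_cancel, zero_mul, zero_add, ← sqrt_one_add_sq] at hu
      dsimp only at hu h2
      have hc : Real.cos ψ < Real.cos (Real.arctan p) := by
        rw [Real.cos_arctan, lt_div_iff₀ hr]; linarith
      have hb := Real.arctan_lt_pi_div_two p
      have hb0 := Real.arctan_pos.2 hp
      have hpi := Real.pi_pos
    · by_contra! h
      exact hc.not_ge (Real.cos_le_cos_of_nonneg_of_le_pi h3 (by linarith) (by linarith))
    · by_contra! h
      simp only [arcTime] at h
      rw [← Real.cos_two_pi_sub] at hc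
      exact hc.not_ge (Real.cos_le_cos_of_nonneg_of_le_pi (by linarith) (by linarith)
        (by linarith))
  · rintro ⟨t, ht, e⟩
    have h1 := focusFlow_zero_normSq t (-1, p)
    have h2 := (focusFlow_long_mem (focusStep_zero _ p) (by simpa using hp.le) (by simpa using hp.le)
      ht.1 ht.2).1
    dsimp only at e
    rw [e] at h1 h2
    exact ⟨by simpa using h1, h2⟩

theorem short_circle {p : ℝ} (hp : 0 < p) :
    {z : ℝ × ℝ | z.1 ^ 2 + z.2 ^ 2 = 1 + p ^ 2 ∧ -1 ≤ z.1 ∧ z.1 ≤ 1 ∧ 0 < z.2} =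
    (fun t => focusFlow 0 t (-1, p)) '' Icc 0 (arcTime Real.pi p p) := by
  ext ⟨u, w⟩
  constructor
  · rintro ⟨h1, h2, h2', hw⟩
    obtain ⟨ψ, h3, h4, e⟩ := exists_polar h1
    refine ⟨_, ⟨?_, ?_⟩, e.symm⟩
    all_goals
      have hr : 0 < √(1 + p ^ 2) := Real.sqrt_pos.2 (one_add_sq_pos p)
      have hu := congrArg Prod.fst e
      have hv := congrArg Prod.snd e
      rw [focusFlow_eq_polar, sub_add_cancel, zero_mul, zero_add, ← sqrt_one_add_sq] at hu hv
      dsimp only at hu hv h2 h2' hw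
      have hpi := Real.pi_pos
      have hψ : ψ < Real.pi := by
        by_contra! h
        have := Real.sin_nonneg_of_nonneg_of_le_pi (x := ψ - Real.pi) (by linarith) (by linarith)
        rw [Real.sin_sub_pi] at this
        nlinarith
      have hb := Real.arctan_lt_pi_div_two p
      have hb0 := Real.arctan_pos.2 hp
    · by_contra! h
      have : Real.cos ψ ≤ Real.cos (Real.arctan p) := by
        rw [Real.cos_arctan, le_div_iff₀ hr]; linarith
      exact this.not_gt (Real.cos_lt_cos_of_nonneg_of_le_pi h3 (by linarith) (by linarith))
    · by_contra! h
      simp only [arcTime] at h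
      have : Real.cos (Real.pi - ψ) ≤ Real.cos (Real.arctan p) := by
        rw [Real.cos_pi_sub, Real.cos_arctan, le_div_iff₀ hr]; linarith
      exact this.not_gt (Real.cos_lt_cos_of_nonneg_of_le_pi (by linarith) (by linarith)
        (by linarith))
  · rintro ⟨t, ht, e⟩
    have hs := focusStep_zero Real.pi p
    have h1 := focusFlow_zero_normSq t (-1, p)
    dsimp only at e
    rw [e] at h1
    refine ⟨by simpa using h1, ?_⟩
    rcases ht.1.eq_or_lt with rfl | h0
    · rw [focusFlow_zero] at e
      obtain ⟨rfl, rfl⟩ := Prod.mk.inj e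
      norm_num [hp]
    rcases ht.2.eq_or_lt with rfl | h0'
    · rw [focusFlow_short_end hs] at e
      obtain ⟨rfl, rfl⟩ := Prod.mk.inj e
      norm_num [hp]
    have h2 := focusFlow_short_mem hs (by simpa using hp.le) (by simpa using hp.le) h0 h0'
    rw [e] at h2
    exact ⟨h2.1.le, h2.2.1.le, h2.2.2⟩

/-! ### Filippov solutions of three-zone fields -/

namespace ThreeZoneField

variable {X : ThreeZoneField} {γ : ℝ → ℝ × ℝ}

theorem filippov_of_lt {z : ℝ × ℝ} (h : z.1 < -1) : X.filippov z = {X.L z} := by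
  simp [filippov, h]

theorem filippov_of_mem {z : ℝ × ℝ} (h : -1 < z.1) (h' : z.1 < 1) : X.filippov z = {X.C z} := by
  simp [filippov, h.not_gt, h.ne', h']

theorem filippov_of_gt {z : ℝ × ℝ} (h : 1 < z.1) : X.filippov z = {X.R z} := by
  simp [filippov, (show ¬ z.1 < -1 by linarith), (show z.1 ≠ -1 by linarith), h.not_gt, h.ne']

theorem filippov_subset_right {z : ℝ × ℝ} (hz : -1 < z.1) {S : Set (ℝ × ℝ)} (hS : Convex ℝ S)
    (hC : X.C z ∈ S) (hR : X.R z ∈ S) : X.filippov z ⊆ S := by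
  rw [filippov, if_neg hz.not_gt, if_neg hz.ne']
  split_ifs
  · simpa
  · exact hS.segment_subset hC hR
  · simpa

theorem filippov_subset_left {z : ℝ × ℝ} (hz : z.1 < 1) {S : Set (ℝ × ℝ)} (hS : Convex ℝ S)
    (hL : X.L z ∈ S) (hC : X.C z ∈ S) : X.filippov z ⊆ S := by
  rw [filippov]
  split_ifs
  · simpa
  · exact hS.segment_subset hL hC
  · simpa

/-- A selection of the Filippov field. -/
def selection (X : ThreeZoneField) (z : ℝ × ℝ) : ℝ × ℝ :=
  if z.1 < -1 then X.L z else if z.1 < 1 then X.C z else X.R z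

theorem selection_mem (z : ℝ × ℝ) : X.selection z ∈ X.filippov z := by
  rw [selection, filippov]
  split_ifs <;> first | exact mem_singleton _ | exact right_mem_segment _ _ _ | skip
  linarith

/-- A continuous curve whose velocity is given by the selection off a countable set of times is a
Filippov solution. -/
theorem isSolution_of_hasDerivAt (hL : Continuous X.L) (hC : Continuous X.C) (hR : Continuous X.R)
    (hγ : Continuous γ) {N : Set ℝ} (hN : N.Countable)
    (hd : ∀ t ∉ N, HasDerivAt γ (X.selection (γ t)) t) : X.IsSolution γ := by
  have hm : Measurable X.selection :=
    Measurable.ite (measurableSet_lt measurable_fst measurable_const) hL.measurable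
      (Measurable.ite (measurableSet_lt measurable_fst measurable_const) hC.measurable
        hR.measurable)
  have hi : ∀ s t : ℝ, IntervalIntegrable (fun t => X.selection (γ t)) volume s t := by
    intro s t
    have hg : Continuous fun t => ‖X.L (γ t)‖ + ‖X.C (γ t)‖ + ‖X.R (γ t)‖ := by fun_prop
    refine (hg.intervalIntegrable s t).mono_fun
      (hm.comp hγ.measurable).aestronglyMeasurable (Eventually.of_forall fun t => ?_)
    dsimp only
    rw [Real.norm_of_nonneg (by positivity)]
    have h1 := norm_nonneg (X.L (γ t))
    have h2 := norm_nonneg (X.C (γ t))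
    have h3 := norm_nonneg (X.R (γ t))
    simp only [selection]
    split_ifs <;> linarith
  refine ⟨fun t => X.selection (γ t), hi, fun s t => ?_,
    Eventually.of_forall fun t => selection_mem _⟩
  rw [integral_eq_of_hasDerivAt_off_countable γ _ hN hγ.continuousOn
    (fun x hx => hd x hx.2) (hi s t)]
  abel

theorem IsSolution.continuous (h : X.IsSolution γ) : Continuous γ := by
  obtain ⟨v, hi, hv, -⟩ := h
  have : γ = fun t => γ 0 + ∫ τ in (0 : ℝ)..t, v τ := funext fun t => hv 0 t
  rw [this]
  exact continuous_const.add (intervalIntegral.continuous_primitive hi 0)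

theorem IsSolution.hasDerivAt (h : X.IsSolution γ) {Z : Set (ℝ × ℝ)} {Y : ℝ × ℝ → ℝ × ℝ}
    (hY : Continuous Y) (hZ : ∀ z ∈ Z, X.filippov z = {Y z}) {s t : ℝ}
    (hm : ∀ τ ∈ Ioo s t, γ τ ∈ Z) {τ : ℝ} (hτ : τ ∈ Ioo s t) : HasDerivAt γ (Y (γ τ)) τ := by
  have hc := h.continuous
  obtain ⟨v, hi, hv, hae⟩ := h
  have hYc : Continuous fun r => Y (γ r) := hY.comp hc
  have h1 : HasDerivAt (fun r => γ τ + ∫ x in τ..r, Y (γ x)) (Y (γ τ)) τ :=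
    (intervalIntegral.integral_hasDerivAt_right (hYc.intervalIntegrable _ _)
      (hYc.stronglyMeasurableAtFilter _ _) hYc.continuousAt).const_add _
  refine h1.congr_of_eventuallyEq ?_
  filter_upwards [Ioo_mem_nhds hτ.1 hτ.2] with r hr
  rw [hv τ r]
  congr 1
  refine intervalIntegral.integral_congr_ae ?_
  filter_upwards [hae] with x hx hxr
  have hxm : x ∈ Ioo s t := by
    have := uIoc_subset_uIcc hxr
    exact (ordConnected_Ioo.uIcc_subset hτ hr) this
  rw [hZ _ (hm x hxm)] at hx
  exact hx

/-- If all Filippov velocities near `γ t₀` point to the side `σ` then so does the motion. -/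
theorem IsSolution.exists_strictMono (h : X.IsSolution γ) {σ c t₀ : ℝ} (hc : 0 < c)
    (hf : ∀ᶠ z in 𝓝 (γ t₀), ∀ v ∈ X.filippov z, c ≤ σ * v.1) :
    ∃ δ > 0, ∀ r t, t₀ - δ < r → r < t → t < t₀ + δ → σ * (γ r).1 < σ * (γ t).1 := by
  obtain ⟨δ, hδ, hb⟩ := Metric.eventually_nhds_iff.1 (h.continuous.continuousAt.eventually hf)
  obtain ⟨v, hi, hv, hae⟩ := h
  refine ⟨δ, hδ, fun r t h1 h2 h3 => ?_⟩
  have e1 : (γ t).1 = (γ r).1 + ∫ x in r..t, (v x).1 := by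
    have := ContinuousLinearMap.intervalIntegral_comp_comm (ContinuousLinearMap.fst ℝ ℝ ℝ) (hi r t)
    simp only [ContinuousLinearMap.coe_fst'] at this
    rw [this, hv r t]; rfl
  have hi1 : IntervalIntegrable (fun x => (v x).1) volume r t :=
    ⟨(hi r t).1.fst, (hi r t).2.fst⟩
  have e2 : ∫ _ in r..t, c ≤ ∫ x in r..t, σ * (v x).1 := by
    refine intervalIntegral.integral_mono_ae_restrict h2.le intervalIntegrable_const
      (hi1.const_mul σ) ?_
    filter_upwards [ae_restrict_of_ae hae, ae_restrict_mem measurableSet_Icc] with x hx hx'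
    refine hb (y := x) ?_ _ hx
    rw [Real.dist_eq, abs_lt]
    exact ⟨by linarith [hx'.1], by linarith [hx'.2]⟩
  rw [intervalIntegral.integral_const_mul, intervalIntegral.integral_const, smul_eq_mul] at e2
  have : 0 < (t - r) * c := mul_pos (sub_pos.2 h2) hc
  rw [e1, mul_add]
  linarith

/-- An affine chart `q ↦ o + A q` in which the field `Y` is `focusField a`. -/
def IsFocusChart (Y : ℝ × ℝ → ℝ × ℝ) (a : ℝ) (o : ℝ × ℝ) (A : (ℝ × ℝ) ≃L[ℝ] (ℝ × ℝ)) : Prop :=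
  ∀ q, Y (o + A q) = A (focusField a q)

theorem IsFocusChart.hasDerivAt {Y : ℝ × ℝ → ℝ × ℝ} {a : ℝ} {o : ℝ × ℝ}
    {A : (ℝ × ℝ) ≃L[ℝ] (ℝ × ℝ)} (hA : IsFocusChart Y a o A) (t : ℝ) (q : ℝ × ℝ) :
    HasDerivAt (fun t => o + A (focusFlow a t q)) (Y (o + A (focusFlow a t q))) t := by
  rw [hA]
  exact (A.hasFDerivAt.comp_hasDerivAt t (hasDerivAt_focusFlow a t q)).const_add o

theorem IsSolution.eq_focusFlow (h : X.IsSolution γ) {Z : Set (ℝ × ℝ)} {Y : ℝ × ℝ → ℝ × ℝ}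
    (hY : Continuous Y) (hZ : ∀ z ∈ Z, X.filippov z = {Y z}) {a : ℝ} {o : ℝ × ℝ}
    {A : (ℝ × ℝ) ≃L[ℝ] (ℝ × ℝ)} (hA : IsFocusChart Y a o A) {s t : ℝ}
    (hm : ∀ τ ∈ Ioo s t, γ τ ∈ Z) {τ : ℝ} (hτ : τ ∈ Icc s t) :
    γ τ = o + A (focusFlow a (τ - s) (A.symm (γ s - o))) := by
  have hc := h.continuous
  have := eq_focusFlow_of_hasDerivAt (a := a) (s := s) (t := t)
    (q := fun r => A.symm (γ r - o)) (by fun_prop) (fun r hr => by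
      have h1 := A.symm.hasFDerivAt.comp_hasDerivAt r ((h.hasDerivAt hY hZ hm hr).sub_const o)
      refine h1.congr_deriv ?_
      have := hA (A.symm (γ r - o))
      rw [A.apply_symm_apply, add_sub_cancel] at this
      rw [this]
      exact A.symm_apply_apply _) τ hτ
  rw [← this, A.apply_symm_apply, add_sub_cancel]

theorem _root_.focusFlow_focusFlow (a s t : ℝ) (q : ℝ × ℝ) :
    focusFlow a s (focusFlow a t q) = focusFlow a (t + s) q := by
  simp only [focusFlow, mul_add, Real.exp_add, Real.cos_add, Real.sin_add, Prod.mk.injEq]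
  constructor <;> ring

/-- A solution that enters a zone follows the arc of the focus of this zone, as long as the arc
stays in the zone. -/
theorem IsSolution.follow (h : X.IsSolution γ) {Z : Set (ℝ × ℝ)} (hZo : IsOpen Z)
    {Y : ℝ × ℝ → ℝ × ℝ}
    (hY : Continuous Y) (hZ : ∀ z ∈ Z, X.filippov z = {Y z}) {a : ℝ} {o : ℝ × ℝ}
    {A : (ℝ × ℝ) ≃L[ℝ] (ℝ × ℝ)} (hA : IsFocusChart Y a o A) {t₀ T : ℝ} {q : ℝ × ℝ}
    (h0 : γ t₀ = o + A q) (hT : ∀ t ∈ Ioo 0 T, o + A (focusFlow a t q) ∈ Z)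
    (hs : ∃ δ > 0, ∀ t ∈ Ioo t₀ (t₀ + δ), γ t ∈ Z) :
    ∀ t ∈ Icc 0 T, γ (t₀ + t) = o + A (focusFlow a t q) := by
  have hc := h.continuous
  have hfc := continuous_focusFlow a q
  refine IsClosed.Icc_subset_of_forall_exists_gt
    (s := {t | γ (t₀ + t) = o + A (focusFlow a t q)}) ?_ ?_ ?_
  · exact (isClosed_eq (by fun_prop) (by fun_prop)).inter isClosed_Icc
  · simp [h0, focusFlow_zero]
  · rintro x ⟨hx, hx0, hxT⟩ y hy
    have hloc : ∃ δ > 0, ∀ t ∈ Ioo (t₀ + x) (t₀ + x + δ), γ t ∈ Z := by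
      rcases hx0.eq_or_lt with rfl | hx0
      · simpa using hs
      · have hZx : γ (t₀ + x) ∈ Z := by rw [show γ (t₀ + x) = _ from hx]; exact hT x ⟨hx0, hxT⟩
        obtain ⟨δ, hδ, hb⟩ := Metric.eventually_nhds_iff.1
          (hc.continuousAt.eventually (hZo.mem_nhds hZx))
        refine ⟨δ, hδ, fun t ht => hb ?_⟩
        rw [Real.dist_eq, abs_lt]
        exact ⟨by linarith [ht.1], by linarith [ht.2]⟩
    obtain ⟨δ, hδ, hm⟩ := hloc
    rw [mem_Ioi] at hy
    refine ⟨min y (x + δ), ?_, lt_min hy (by linarith), min_le_left _ _⟩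
    have h1 : x < min y (x + δ) := lt_min hy (by linarith)
    have h2 : min y (x + δ) ≤ x + δ := min_le_right _ _
    have := h.eq_focusFlow hY hZ hA hm (τ := t₀ + min y (x + δ))
      ⟨by linarith, by linarith⟩
    rw [mem_ofPred_eq, this, show γ (t₀ + x) = _ from hx, add_sub_cancel_left, A.symm_apply_apply,
      focusFlow_focusFlow]
    congr 3
    ring

/-- A continuous curve that starts in an open set stays there or reaches the boundary. -/
theorem _root_.Continuous.forall_mem_or_exists_exit {A : Set (ℝ × ℝ)} (hγ : Continuous γ)
    (hA : IsOpen A) {s : ℝ} (hs : γ s ∈ A) :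
    (∀ t ≥ s, γ t ∈ A) ∨ ∃ t > s, (∀ r ∈ Ico s t, γ r ∈ A) ∧ γ t ∈ closure A \ A := by
  by_contra! hcon
  obtain ⟨⟨t₁, ht₁, hn⟩, h2⟩ := hcon
  let B : Set ℝ := Ici s ∩ γ ⁻¹' Aᶜ
  have hB : IsClosed B := isClosed_Ici.inter (hA.isClosed_compl.preimage hγ)
  have hbb : BddBelow B := ⟨s, fun x hx => hx.1⟩
  have hmem : sInf B ∈ B := hB.csInf_mem ⟨t₁, ht₁, hn⟩ hbb
  have hlt : s < sInf B := lt_of_le_of_ne hmem.1 (fun e => hmem.2 (e ▸ hs))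
  have hin : ∀ r ∈ Ico s (sInf B), γ r ∈ A := by
    intro r hr
    by_contra hrA
    exact (csInf_le hbb ⟨hr.1, hrA⟩).not_gt hr.2
  refine h2 _ hlt hin ⟨?_, hmem.2⟩
  have : sInf B ∈ closure (Ico s (sInf B)) := by
    rw [closure_Ico hlt.ne]; exact ⟨hlt.le, le_rfl⟩
  exact (hγ.closure_preimage_subset A) (closure_mono (fun r hr => hin r hr) this)

/-- Periodic extension of a closed piecewise smooth solution. -/
theorem exists_periodic_solution (hL : Continuous X.L) (hC : Continuous X.C) (hR : Continuous X.R)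
    {c : ℝ → ℝ × ℝ} {T : ℝ} (hT : 0 < T) (hc : ContinuousOn c (Icc 0 T)) (h0 : c 0 = c T)
    {N : Set ℝ} (hN : N.Countable)
    (hd : ∀ t ∈ Ioo 0 T, t ∉ N → HasDerivAt c (X.selection (c t)) t) :
    ∃ γ : ℝ → ℝ × ℝ, X.IsSolution γ ∧ Function.Periodic γ T ∧ range γ = c '' Icc 0 T := by
  have : Fact (0 < T) := ⟨hT⟩
  let g : ℝ → ℝ × ℝ := fun t => AddCircle.liftIco T 0 c (t : AddCircle T)
  have hgc : Continuous g := (AddCircle.liftIco_zero_continuous h0 hc).comp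
    (AddCircle.continuous_mk' T)
  have hgp : Function.Periodic g T := fun t => by
    simp only [g, AddCircle.coe_add, AddCircle.coe_period, add_zero]
  have hge : ∀ t ∈ Ico 0 T, g t = c t := fun t ht => AddCircle.liftIco_zero_coe_apply ht
  refine ⟨g, isSolution_of_hasDerivAt hL hC hR hgc
    (N := ⋃ n : ℤ, (fun t => t + n • T) '' (N ∪ {0})) ?_ ?_, hgp, ?_⟩
  · exact countable_iUnion fun n => (hN.union (countable_singleton 0)).image _
  · intro t ht
    obtain ⟨n, hn, -⟩ := existsUnique_sub_zsmul_mem_Ico hT t 0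
    rw [zero_add] at hn
    have hnot : t - n • T ∉ N ∪ {0} := fun hmem =>
      ht (mem_iUnion.2 ⟨n, _, hmem, sub_add_cancel _ _⟩)
    have hin : t - n • T ∈ Ioo 0 T :=
      ⟨lt_of_le_of_ne hn.1 fun e => hnot (Or.inr e.symm), hn.2⟩
    have hshift : ∀ r, g r = g (r - n • T) := fun r => (hgp.sub_zsmul_eq n).symm
    have h1 := (hd _ hin fun hm => hnot (Or.inl hm)).comp_sub_const t (n • T)
    rw [← hge _ hn, ← hshift] at h1
    refine h1.congr_of_eventuallyEq ?_
    have hcont : ContinuousAt (fun r : ℝ => r - n • T) t := by fun_prop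
    filter_upwards [hcont.eventually (Ioo_mem_nhds hin.1 hin.2)] with r hr
    rw [hshift r, hge _ (Ioo_subset_Ico_self hr)]
  · rw [← hgp.image_Icc hT 0, zero_add]
    refine image_congr fun t ht => ?_
    rcases ht.2.eq_or_lt with rfl | hlt
    · have := hgp 0
      rw [zero_add] at this
      rw [this, hge 0 ⟨le_rfl, hT⟩, h0]
    · exact hge t ⟨ht.1, hlt⟩

end ThreeZoneField

/-! ### The perturbed system: three foci of angular speed one -/

/-- The three-zone field with foci at `(-5, 2)`, `(0, 0)`, `(2, 0)`: the unperturbed field plus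
`c (z - (-5, 2))`, `b z`, `a (z - (2, 0))` in the left, central and right zone. -/
def spiralField (a b c : ℝ) : ThreeZoneField where
  L z := (z.1 + 2 * z.2 + 1 + c * (z.1 + 5), -z.1 - z.2 - 3 + c * (z.2 - 2))
  C z := (z.2 + b * z.1, -z.1 + b * z.2)
  R z := (z.2 + a * (z.1 - 2), -(z.1 - 2) + a * z.2)

theorem continuous_spiralField_L (a b c : ℝ) : Continuous (spiralField a b c).L := by
  simp only [spiralField]; fun_prop

theorem continuous_spiralField_C (a b c : ℝ) : Continuous (spiralField a b c).C := by
  simp only [spiralField]; fun_prop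

theorem continuous_spiralField_R (a b c : ℝ) : Continuous (spiralField a b c).R := by
  simp only [spiralField]; fun_prop

/-- The linear part of the chart of the left zone. -/
def leftChart : (ℝ × ℝ) ≃L[ℝ] (ℝ × ℝ) :=
  LinearEquiv.toContinuousLinearEquiv
    { toFun := fun q => (-4 * q.1, 2 * q.1 - 2 * q.2)
      invFun := fun z => (-z.1 / 4, -z.1 / 4 - z.2 / 2)
      map_add' := fun q q' => by ext <;> simp <;> ring
      map_smul' := fun r q => by ext <;> simp <;> ring
      left_inv := fun q => by ext <;> dsimp only <;> ring
      right_inv := fun q => by ext <;> dsimp only <;> ring }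

theorem leftChart_apply (q : ℝ × ℝ) : leftChart q = (-4 * q.1, 2 * q.1 - 2 * q.2) := rfl

theorem isFocusChart_R (a b c : ℝ) : ThreeZoneField.IsFocusChart (spiralField a b c).R a (2, 0)
    (ContinuousLinearEquiv.refl ℝ (ℝ × ℝ)) := fun q => by
  ext <;> simp [spiralField, focusField]

theorem isFocusChart_upper (a b c : ℝ) : ThreeZoneField.IsFocusChart (spiralField a b c).C b 0
    (ContinuousLinearEquiv.refl ℝ (ℝ × ℝ)) := fun q => by
  ext <;> simp [spiralField, focusField]

theorem isFocusChart_lower (a b c : ℝ) : ThreeZoneField.IsFocusChart (spiralField a b c).C b 0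
    (ContinuousLinearEquiv.neg ℝ (M := ℝ × ℝ)) := fun q => by
  ext <;> simp [spiralField, focusField] <;> ring

theorem isFocusChart_L (a b c : ℝ) : ThreeZoneField.IsFocusChart (spiralField a b c).L c (-5, 2)
    leftChart := fun q => by
  ext <;> simp [spiralField, focusField, leftChart_apply] <;> ring

/-- The orbit of the right zone that starts at `(1, p)`. -/
def arcR (a p t : ℝ) : ℝ × ℝ :=
  (2, 0) + ContinuousLinearEquiv.refl ℝ (ℝ × ℝ) (focusFlow a t (-1, p))

/-- The orbit of the central zone that starts at `(1, -p)`. -/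
def arcLower (b p t : ℝ) : ℝ × ℝ :=
  0 + ContinuousLinearEquiv.neg ℝ (M := ℝ × ℝ) (focusFlow b t (-1, p))

/-- The orbit of the left zone that starts at `(-1, -2 p)`. -/
def arcL (c p t : ℝ) : ℝ × ℝ := (-5, 2) + leftChart (focusFlow c t (-1, p))

/-- The orbit of the central zone that starts at `(-1, p)`. -/
def arcUpper (b p t : ℝ) : ℝ × ℝ :=
  0 + ContinuousLinearEquiv.refl ℝ (ℝ × ℝ) (focusFlow b t (-1, p))

theorem arcR_eq (a p t : ℝ) :
    arcR a p t = (2 + (focusFlow a t (-1, p)).1, (focusFlow a t (-1, p)).2) := by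
  ext <;> simp [arcR]

theorem arcLower_eq (b p t : ℝ) :
    arcLower b p t = (-(focusFlow b t (-1, p)).1, -(focusFlow b t (-1, p)).2) := by
  ext <;> simp [arcLower]

theorem arcL_eq (c p t : ℝ) : arcL c p t = (-5 - 4 * (focusFlow c t (-1, p)).1,
    2 + 2 * (focusFlow c t (-1, p)).1 - 2 * (focusFlow c t (-1, p)).2) := by
  ext <;> simp [arcL, leftChart_apply] <;> ring

theorem arcUpper_eq (b p t : ℝ) : arcUpper b p t = focusFlow b t (-1, p) := by
  simp [arcUpper]

/-- The ordinates `h₀, -h₁, -h₂, h₃, h₄` of the successive intersections of an orbit of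
`spiralField a b c` with the lines `x = ± 1`. All of them are larger than `η` in absolute value, and
`η` bounds the heights of the tangency points of the field on these lines. -/
structure OrbitChain (η a b c h₀ h₁ h₂ h₃ h₄ : ℝ) : Prop where
  abs_a : |a| ≤ η
  abs_b : |b| ≤ η
  abs_c : |c| ≤ η / 2
  lt₀ : η < h₀
  lt₁ : η < h₁
  lt₂ : η < h₂
  lt₃ : η < h₃
  lt₄ : η < h₄
  right : FocusStep (2 * Real.pi) a h₀ h₁
  lower : FocusStep Real.pi b h₁ h₂
  left : FocusStep (2 * Real.pi) c (h₂ / 2) (h₃ / 2)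
  upper : FocusStep Real.pi b h₃ h₄

/-- The union of the four arcs of an orbit that starts at `(1, h₀)`, until it meets the half-line
`x = 1`, `y > 0` again. -/
def loopSet (a b c h₀ h₁ h₂ h₃ h₄ : ℝ) : Set (ℝ × ℝ) :=
  arcR a h₀ '' Icc 0 (arcTime (2 * Real.pi) h₀ h₁) ∪
  arcLower b h₁ '' Icc 0 (arcTime Real.pi h₁ h₂) ∪
  arcL c (h₂ / 2) '' Icc 0 (arcTime (2 * Real.pi) (h₂ / 2) (h₃ / 2)) ∪
  arcUpper b h₃ '' Icc 0 (arcTime Real.pi h₃ h₄)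

section Arcs

variable {η a b c h₀ h₁ h₂ h₃ h₄ : ℝ}

theorem arcR_zero (a p : ℝ) : arcR a p 0 = (1, p) := by
  rw [arcR_eq, focusFlow_zero]; norm_num

theorem arcLower_zero (b p : ℝ) : arcLower b p 0 = (1, -p) := by
  rw [arcLower_eq, focusFlow_zero]; norm_num

theorem arcL_zero (c p : ℝ) : arcL c (p / 2) 0 = (-1, -p) := by
  rw [arcL_eq, focusFlow_zero]; ext <;> dsimp only <;> ring

theorem arcUpper_zero (b p : ℝ) : arcUpper b p 0 = (-1, p) := by
  rw [arcUpper_eq, focusFlow_zero]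

namespace OrbitChain

variable (H : OrbitChain η a b c h₀ h₁ h₂ h₃ h₄)
include H

theorem eta_nonneg : 0 ≤ η := (abs_nonneg a).trans H.abs_a

theorem arcR_end : arcR a h₀ (arcTime (2 * Real.pi) h₀ h₁) = (1, -h₁) := by
  rw [arcR_eq, focusFlow_long_end H.right]; norm_num

theorem arcLower_end : arcLower b h₁ (arcTime Real.pi h₁ h₂) = (-1, -h₂) := by
  rw [arcLower_eq, focusFlow_short_end H.lower]

theorem arcL_end :
    arcL c (h₂ / 2) (arcTime (2 * Real.pi) (h₂ / 2) (h₃ / 2)) = (-1, h₃) := by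
  rw [arcL_eq, focusFlow_long_end H.left]; ext <;> dsimp only <;> ring

theorem arcUpper_end : arcUpper b h₃ (arcTime Real.pi h₃ h₄) = (1, h₄) := by
  rw [arcUpper_eq, focusFlow_short_end H.upper]

theorem arcR_mem {t : ℝ} (ht : t ∈ Ioo 0 (arcTime (2 * Real.pi) h₀ h₁)) :
    1 < (arcR a h₀ t).1 ∧ ((arcR a h₀ t).2 = 0 → 2 < (arcR a h₀ t).1) := by
  have := focusFlow_long_mem H.right (H.abs_a.trans H.lt₀.le) (H.abs_a.trans H.lt₁.le) ht.1 ht.2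
  rw [arcR_eq]
  exact ⟨by dsimp only; linarith [this.1], fun h => by have := this.2 h; dsimp only; linarith⟩

theorem arcLower_mem {t : ℝ} (ht : t ∈ Ioo 0 (arcTime Real.pi h₁ h₂)) :
    -1 < (arcLower b h₁ t).1 ∧ (arcLower b h₁ t).1 < 1 ∧ (arcLower b h₁ t).2 < 0 := by
  have := focusFlow_short_mem H.lower (H.abs_b.trans H.lt₁.le) (H.abs_b.trans H.lt₂.le) ht.1 ht.2
  rw [arcLower_eq]
  dsimp only
  exact ⟨by linarith, by linarith, by linarith⟩

theorem arcL_mem {t : ℝ} (ht : t ∈ Ioo 0 (arcTime (2 * Real.pi) (h₂ / 2) (h₃ / 2))) :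
    (arcL c (h₂ / 2) t).1 < -1 ∧ ((arcL c (h₂ / 2) t).1 + 2 * (arcL c (h₂ / 2) t).2 + 1 = 0 →
      (arcL c (h₂ / 2) t).1 < -5) := by
  have := focusFlow_long_mem H.left (H.abs_c.trans (by linarith [H.lt₂]))
    (H.abs_c.trans (by linarith [H.lt₃])) ht.1 ht.2
  rw [arcL_eq]
  dsimp only
  exact ⟨by linarith, fun h => by have := this.2 (by linarith); linarith⟩

theorem arcUpper_mem {t : ℝ} (ht : t ∈ Ioo 0 (arcTime Real.pi h₃ h₄)) :
    -1 < (arcUpper b h₃ t).1 ∧ (arcUpper b h₃ t).1 < 1 ∧ 0 < (arcUpper b h₃ t).2 := by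
  rw [arcUpper_eq]
  exact focusFlow_short_mem H.upper (H.abs_b.trans H.lt₃.le) (H.abs_b.trans H.lt₄.le) ht.1 ht.2

end OrbitChain

theorem mem_Icc_cases {t T : ℝ} (ht : t ∈ Icc 0 T) : t = 0 ∨ t = T ∨ t ∈ Ioo 0 T := by
  rcases ht.1.eq_or_lt with h | h
  · exact Or.inl h.symm
  rcases ht.2.eq_or_lt with h' | h'
  · exact Or.inr (Or.inl h')
  · exact Or.inr (Or.inr ⟨h, h'⟩)

/-- The position of the points of an orbit with respect to the three zones. -/
theorem OrbitChain.loopSet_cases (H : OrbitChain η a b c h₀ h₁ h₂ h₃ h₄) {z : ℝ × ℝ}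
    (hz : z ∈ loopSet a b c h₀ h₁ h₂ h₃ h₄) :
    (1 < z.1 ∧ (z.2 = 0 → 2 < z.1)) ∨ (-1 < z.1 ∧ z.1 < 1 ∧ z.2 ≠ 0) ∨
    (z.1 < -1 ∧ (z.1 + 2 * z.2 + 1 = 0 → z.1 < -5)) ∨
    z = (1, h₀) ∨ z = (1, -h₁) ∨ z = (-1, -h₂) ∨ z = (-1, h₃) ∨ z = (1, h₄) := by
  rcases hz with ((⟨t, ht, rfl⟩ | ⟨t, ht, rfl⟩) | ⟨t, ht, rfl⟩) | ⟨t, ht, rfl⟩ <;>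
    rcases mem_Icc_cases ht with rfl | rfl | ht
  · simp [arcR_zero]
  · simp [H.arcR_end]
  · exact Or.inl (H.arcR_mem ht)
  · simp [arcLower_zero]
  · simp [H.arcLower_end]
  · have := H.arcLower_mem ht
    exact Or.inr (Or.inl ⟨this.1, this.2.1, this.2.2.ne⟩)
  · simp [arcL_zero]
  · simp [H.arcL_end]
  · exact Or.inr (Or.inr (Or.inl (H.arcL_mem ht)))
  · simp [arcUpper_zero]
  · simp [H.arcUpper_end]
  · have := H.arcUpper_mem ht
    exact Or.inr (Or.inl ⟨this.1, this.2.1, this.2.2.ne'⟩)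

/-! ### Following an orbit through the zones -/

/-- Above the height `η` the field points to the right on the lines `x = ± 1`, below the height
`-η` it points to the left. -/
theorem spiralField_crossing_fst (ha : |a| ≤ η) (hb : |b| ≤ η) (hc : |c| ≤ η / 2) {σ : ℝ}
    (hσ : σ = 1 ∨ σ = -1) {z : ℝ × ℝ} (hz : η < σ * z.2) :
    (z.1 = 1 → 0 < σ * ((spiralField a b c).C z).1 ∧ 0 < σ * ((spiralField a b c).R z).1) ∧
    (z.1 = -1 → 0 < σ * ((spiralField a b c).L z).1 ∧ 0 < σ * ((spiralField a b c).C z).1) := by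
  rw [abs_le] at ha hb hc
  rcases hσ with rfl | rfl <;> refine ⟨fun h => ?_, fun h => ?_⟩ <;>
    simp only [spiralField, h] <;> constructor <;> linarith

theorem exists_filippov_crossing (ha : |a| ≤ η) (hb : |b| ≤ η) (hc : |c| ≤ η / 2) {σ : ℝ}
    (hσ : σ = 1 ∨ σ = -1) {z : ℝ × ℝ} (hz : η < σ * z.2) (hx : z.1 = 1 ∨ z.1 = -1) :
    ∃ m > 0, ∀ᶠ z' in 𝓝 z, ∀ v ∈ (spiralField a b c).filippov z', m ≤ σ * v.1 := by
  have hconv : ∀ m : ℝ, Convex ℝ {v : ℝ × ℝ | m ≤ σ * v.1} := fun m =>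
    convex_halfSpace_ge (f := fun v : ℝ × ℝ => σ * v.1)
      ⟨fun _ _ => by simp [mul_add], fun _ _ => by simp; ring⟩ m
  have hev : ∀ Y : ℝ × ℝ → ℝ × ℝ, Continuous Y → ∀ m : ℝ, m < σ * (Y z).1 →
      ∀ᶠ z' in 𝓝 z, m < σ * (Y z').1 := fun Y hY m hm =>
    (show Continuous fun z => σ * (Y z).1 by fun_prop).continuousAt.eventually_const_lt hm
  have hcr := spiralField_crossing_fst ha hb hc hσ hz
  have hC := continuous_spiralField_C a b c
  rcases hx with hx | hx
  · obtain ⟨h1, h2⟩ := hcr.1 hx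
    obtain ⟨m, hm, hm'⟩ := exists_between (lt_min h1 h2)
    refine ⟨m, hm, ?_⟩
    filter_upwards [hev _ hC m (hm'.trans_le (min_le_left _ _)),
      hev _ (continuous_spiralField_R a b c) m (hm'.trans_le (min_le_right _ _)),
      continuous_fst.continuousAt.eventually_const_lt (show (-1 : ℝ) < z.1 by rw [hx]; norm_num)]
      with z' e1 e2 e3
    exact ThreeZoneField.filippov_subset_right e3 (hconv m) e1.le e2.le
  · obtain ⟨h1, h2⟩ := hcr.2 hx
    obtain ⟨m, hm, hm'⟩ := exists_between (lt_min h1 h2)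
    refine ⟨m, hm, ?_⟩
    filter_upwards [hev _ (continuous_spiralField_L a b c) m (hm'.trans_le (min_le_left _ _)),
      hev _ hC m (hm'.trans_le (min_le_right _ _)),
      continuous_fst.continuousAt.eventually_lt_const (show z.1 < (1 : ℝ) by rw [hx]; norm_num)]
      with z' e1 e2 e3
    exact ThreeZoneField.filippov_subset_left e3 (hconv m) e1.le e2.le

variable {γ : ℝ → ℝ × ℝ}

theorem exists_crossing_up (ha : |a| ≤ η) (hb : |b| ≤ η) (hc : |c| ≤ η / 2)
    (hγ : (spiralField a b c).IsSolution γ) {t₀ : ℝ} (hx : (γ t₀).1 = 1 ∨ (γ t₀).1 = -1)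
    (hy : η < (γ t₀).2) :
    ∃ δ > 0, ∀ r t, t₀ - δ < r → r < t → t < t₀ + δ → (γ r).1 < (γ t).1 := by
  obtain ⟨m, hm, hf⟩ := exists_filippov_crossing ha hb hc (σ := 1) (Or.inl rfl) (by simpa) hx
  simpa using hγ.exists_strictMono hm hf

theorem exists_crossing_down (ha : |a| ≤ η) (hb : |b| ≤ η) (hc : |c| ≤ η / 2)
    (hγ : (spiralField a b c).IsSolution γ) {t₀ : ℝ} (hx : (γ t₀).1 = 1 ∨ (γ t₀).1 = -1)
    (hy : (γ t₀).2 < -η) :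
    ∃ δ > 0, ∀ r t, t₀ - δ < r → r < t → t < t₀ + δ → (γ t).1 < (γ r).1 := by
  obtain ⟨m, hm, hf⟩ := exists_filippov_crossing ha hb hc (σ := -1) (Or.inr rfl)
    (by linarith : η < -1 * (γ t₀).2) hx
  simpa using hγ.exists_strictMono hm hf

theorem isOpen_zoneL : IsOpen zoneL := isOpen_lt continuous_fst continuous_const

theorem isOpen_zoneR : IsOpen zoneR := isOpen_lt continuous_const continuous_fst

theorem isOpen_zoneC : IsOpen zoneC :=
  (isOpen_lt continuous_const continuous_fst).inter (isOpen_lt continuous_fst continuous_const)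

namespace OrbitChain

variable (H : OrbitChain η a b c h₀ h₁ h₂ h₃ h₄) (hγ : (spiralField a b c).IsSolution γ) {t₀ : ℝ}
include H hγ

theorem follow_right (h0 : γ t₀ = (1, h₀)) :
    ∀ t ∈ Icc 0 (arcTime (2 * Real.pi) h₀ h₁), γ (t₀ + t) = arcR a h₀ t := by
  refine hγ.follow isOpen_zoneR (continuous_spiralField_R a b c)
    (fun z hz => ThreeZoneField.filippov_of_gt hz) (isFocusChart_R a b c) ?_
    (fun t ht => (H.arcR_mem ht).1) ?_
  · rw [h0]; ext <;> norm_num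
  · obtain ⟨δ, hδ, hm⟩ := exists_crossing_up H.abs_a H.abs_b H.abs_c hγ (t₀ := t₀)
      (by simp [h0]) (by simpa [h0] using H.lt₀)
    refine ⟨δ, hδ, fun t ht => ?_⟩
    have := hm t₀ t (by linarith) ht.1 ht.2
    rwa [h0] at this

theorem follow_lower (h0 : γ t₀ = (1, -h₁)) :
    ∀ t ∈ Icc 0 (arcTime Real.pi h₁ h₂), γ (t₀ + t) = arcLower b h₁ t := by
  refine hγ.follow isOpen_zoneC (continuous_spiralField_C a b c)
    (fun z hz => ThreeZoneField.filippov_of_mem hz.1 hz.2) (isFocusChart_lower a b c) ?_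
    (fun t ht => ⟨(H.arcLower_mem ht).1, (H.arcLower_mem ht).2.1⟩) ?_
  · rw [h0]; ext <;> simp
  · obtain ⟨δ, hδ, hm⟩ := exists_crossing_down H.abs_a H.abs_b H.abs_c hγ (t₀ := t₀)
      (by simp [h0]) (by simpa [h0] using H.lt₁)
    obtain ⟨δ', hδ', hm'⟩ := Metric.eventually_nhds_iff.1
      ((hγ.continuous.fst.continuousAt (x := t₀)).eventually_const_lt
        (show (-1 : ℝ) < (γ t₀).1 by rw [h0]; norm_num))
    refine ⟨min δ δ', lt_min hδ hδ', fun t ht => ⟨hm' ?_, ?_⟩⟩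
    · rw [Real.dist_eq, abs_lt]
      exact ⟨by linarith [ht.1], by linarith [ht.2, min_le_right δ δ']⟩
    · have := hm t₀ t (by linarith) ht.1 (by linarith [ht.2, min_le_left δ δ'])
      rwa [h0] at this

theorem follow_left (h0 : γ t₀ = (-1, -h₂)) :
    ∀ t ∈ Icc 0 (arcTime (2 * Real.pi) (h₂ / 2) (h₃ / 2)), γ (t₀ + t) = arcL c (h₂ / 2) t := by
  refine hγ.follow isOpen_zoneL (continuous_spiralField_L a b c)
    (fun z hz => ThreeZoneField.filippov_of_lt hz) (isFocusChart_L a b c) ?_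
    (fun t ht => (H.arcL_mem ht).1) ?_
  · rw [h0, leftChart_apply]; ext <;> dsimp only [Prod.fst_add, Prod.snd_add] <;> ring
  · obtain ⟨δ, hδ, hm⟩ := exists_crossing_down H.abs_a H.abs_b H.abs_c hγ (t₀ := t₀)
      (by simp [h0]) (by simpa [h0] using H.lt₂)
    refine ⟨δ, hδ, fun t ht => ?_⟩
    have := hm t₀ t (by linarith) ht.1 ht.2
    rwa [h0] at this

theorem follow_upper (h0 : γ t₀ = (-1, h₃)) :
    ∀ t ∈ Icc 0 (arcTime Real.pi h₃ h₄), γ (t₀ + t) = arcUpper b h₃ t := by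
  refine hγ.follow isOpen_zoneC (continuous_spiralField_C a b c)
    (fun z hz => ThreeZoneField.filippov_of_mem hz.1 hz.2) (isFocusChart_upper a b c) ?_
    (fun t ht => ⟨(H.arcUpper_mem ht).1, (H.arcUpper_mem ht).2.1⟩) ?_
  · rw [h0]; ext <;> simp
  · obtain ⟨δ, hδ, hm⟩ := exists_crossing_up H.abs_a H.abs_b H.abs_c hγ (t₀ := t₀)
      (by simp [h0]) (by simpa [h0] using H.lt₃)
    obtain ⟨δ', hδ', hm'⟩ := Metric.eventually_nhds_iff.1
      ((hγ.continuous.fst.continuousAt (x := t₀)).eventually_lt_const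
        (show (γ t₀).1 < (1 : ℝ) by rw [h0]; norm_num))
    refine ⟨min δ δ', lt_min hδ hδ', fun t ht => ⟨?_, hm' ?_⟩⟩
    · have := hm t₀ t (by linarith) ht.1 (by linarith [ht.2, min_le_left δ δ'])
      rwa [h0] at this
    · rw [Real.dist_eq, abs_lt]
      exact ⟨by linarith [ht.1], by linarith [ht.2, min_le_right δ δ']⟩

end OrbitChain

end Arcs

/-! ### Closed orbits -/

section Closed

variable {η a b c h₀ h₁ h₂ h₃ h₄ : ℝ} {γ : ℝ → ℝ × ℝ}

/-- The time an orbit needs to run through `loopSet`. -/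
def loopTime (h₀ h₁ h₂ h₃ h₄ : ℝ) : ℝ :=
  arcTime (2 * Real.pi) h₀ h₁ + arcTime Real.pi h₁ h₂ +
    arcTime (2 * Real.pi) (h₂ / 2) (h₃ / 2) + arcTime Real.pi h₃ h₄

theorem pi_lt_loopTime (h₀ h₁ h₂ h₃ h₄ : ℝ) : Real.pi < loopTime h₀ h₁ h₂ h₃ h₄ := by
  have := pi_lt_arcTime_long h₀ h₁
  have := pi_lt_arcTime_long (h₂ / 2) (h₃ / 2)
  have := arcTime_short_pos h₁ h₂
  have := arcTime_short_pos h₃ h₄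
  have := Real.pi_pos
  simp only [loopTime]; linarith

theorem image_Icc_of_shift_eq {f : ℝ → ℝ × ℝ} {s T : ℝ}
    (h : ∀ t ∈ Icc 0 T, γ (s + t) = f t) : γ '' Icc s (s + T) = f '' Icc 0 T := by
  rw [← image_congr h, ← image_image γ (fun t => s + t), image_const_add_Icc, add_zero]

/-- A Filippov solution that starts at `(1, h₀)` runs through `loopSet`, and it meets the half-line
`x = 1`, `y > 0` only at the end points. -/
theorem OrbitChain.follow (H : OrbitChain η a b c h₀ h₁ h₂ h₃ h₄)
    (hγ : (spiralField a b c).IsSolution γ) {t₀ : ℝ} (h0 : γ t₀ = (1, h₀)) :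
    γ (t₀ + loopTime h₀ h₁ h₂ h₃ h₄) = (1, h₄) ∧
    (∀ t ∈ Ioo t₀ (t₀ + loopTime h₀ h₁ h₂ h₃ h₄), ¬ ((γ t).1 = 1 ∧ 0 < (γ t).2)) ∧
    γ '' Icc t₀ (t₀ + loopTime h₀ h₁ h₂ h₃ h₄) = loopSet a b c h₀ h₁ h₂ h₃ h₄ := by
  have hη := H.eta_nonneg
  have hπ := Real.pi_pos
  have p1 := hπ.trans (pi_lt_arcTime_long h₀ h₁)
  have p2 := arcTime_short_pos h₁ h₂
  have p3 := hπ.trans (pi_lt_arcTime_long (h₂ / 2) (h₃ / 2))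
  have p4 := arcTime_short_pos h₃ h₄
  have f1 := H.follow_right hγ h0
  have m1 := fun t ht => H.arcR_mem (t := t) ht
  have e1 := f1 _ (right_mem_Icc.2 p1.le)
  rw [H.arcR_end] at e1
  have f2 := H.follow_lower hγ e1
  have m2 := fun t ht => H.arcLower_mem (t := t) ht
  have e2 := f2 _ (right_mem_Icc.2 p2.le)
  rw [H.arcLower_end] at e2
  have f3 := H.follow_left hγ e2
  have m3 := fun t ht => H.arcL_mem (t := t) ht
  have e3 := f3 _ (right_mem_Icc.2 p3.le)
  rw [H.arcL_end] at e3
  have f4 := H.follow_upper hγ e3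
  have m4 := fun t ht => H.arcUpper_mem (t := t) ht
  have e4 := f4 _ (right_mem_Icc.2 p4.le)
  rw [H.arcUpper_end] at e4
  have i1 := image_Icc_of_shift_eq f1
  have i2 := image_Icc_of_shift_eq f2
  have i3 := image_Icc_of_shift_eq f3
  have i4 := image_Icc_of_shift_eq f4
  simp only [loopSet, loopTime]
  rw [← i1, ← i2, ← i3, ← i4, ← image_union, ← image_union, ← image_union]
  generalize arcTime (2 * Real.pi) h₀ h₁ = T₁ at *
  generalize arcTime Real.pi h₁ h₂ = T₂ at *
  generalize arcTime (2 * Real.pi) (h₂ / 2) (h₃ / 2) = T₃ at *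
  generalize arcTime Real.pi h₃ h₄ = T₄ at *
  refine ⟨by rw [← e4]; congr 1; ring, fun t ht hneg => ?_, ?_⟩
  · obtain ⟨hx, hy⟩ := hneg
    have hl : ∀ {s T : ℝ}, s < t → t < s + T → t - s ∈ Ioo 0 T := fun h h' =>
      ⟨by linarith, by linarith⟩
    have hI : ∀ {s T : ℝ} {f : ℝ → ℝ × ℝ}, (∀ r ∈ Icc 0 T, γ (s + r) = f r) → s < t →
        t < s + T → γ t = f (t - s) := fun hf h h' => by
      rw [← hf _ (Ioo_subset_Icc_self (hl h h')), add_sub_cancel]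
    rcases lt_trichotomy t (t₀ + T₁) with h | rfl | h
    · have := (m1 _ (hl ht.1 h)).1
      rw [← hI f1 ht.1 h, hx] at this
      exact this.false
    · rw [e1] at hy; exact absurd hy (by linarith [H.lt₁])
    rcases lt_trichotomy t (t₀ + T₁ + T₂) with h' | rfl | h'
    · have := (m2 _ (hl h h')).2.2
      rw [← hI f2 h h'] at this
      exact this.not_gt hy
    · rw [e2] at hy; exact absurd hy (by linarith [H.lt₂])
    rcases lt_trichotomy t (t₀ + T₁ + T₂ + T₃) with h'' | rfl | h''
    · have := (m3 _ (hl h' h'')).1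
      rw [← hI f3 h' h'', hx] at this
      norm_num at this
    · rw [e3] at hx; norm_num at hx
    · have h''' : t < t₀ + T₁ + T₂ + T₃ + T₄ := by linarith [ht.2]
      have := (m4 _ (hl h'' h''')).2.1
      rw [← hI f4 h'' h''', hx] at this
      exact this.false
  · rw [Icc_union_Icc_eq_Icc (by linarith) (by linarith),
      Icc_union_Icc_eq_Icc (by linarith) (by linarith),
      Icc_union_Icc_eq_Icc (by linarith) (by linarith)]
    congr 2; ring

/-- A periodic solution through a fixed point of the return map runs through its loop only. -/
theorem OrbitChain.range_eq (H : OrbitChain η a b c h₀ h₁ h₂ h₃ h₀)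
    (hγ : (spiralField a b c).IsSolution γ) {T : ℝ} (hT : 0 < T) (hp : Function.Periodic γ T)
    {t₀ : ℝ} (h0 : γ t₀ = (1, h₀)) : range γ = loopSet a b c h₀ h₁ h₂ h₃ h₀ := by
  refine Subset.antisymm ?_ ?_
  · set S := loopTime h₀ h₁ h₂ h₃ h₀ with hS
    have hSpos : 0 < S := Real.pi_pos.trans (pi_lt_loopTime _ _ _ _ _)
    have hn : ∀ n : ℕ, γ (t₀ + n * S) = (1, h₀) := by
      intro n
      induction n with
      | zero => simpa using h0
      | succ n ih =>
        rw [← (H.follow hγ ih).1]; congr 1; push_cast; ring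
    rintro _ ⟨t, rfl⟩
    obtain ⟨r, hr, e⟩ := hp.exists_mem_Ico hT t t₀
    rw [e]
    have hfl := Nat.floor_le (div_nonneg (sub_nonneg.2 hr.1) hSpos.le)
    have hfl' := Nat.lt_floor_add_one ((r - t₀) / S)
    rw [le_div_iff₀ hSpos] at hfl
    rw [div_lt_iff₀ hSpos] at hfl'
    rw [← (H.follow hγ (hn ⌊(r - t₀) / S⌋₊)).2.2]
    exact ⟨r, ⟨by linarith, by linarith⟩, rfl⟩
  · rw [← (H.follow hγ h0).2.2]
    exact image_subset_range _ _

theorem OrbitChain.isPeriodicOrbit (H : OrbitChain η a b c h₀ h₁ h₂ h₃ h₀) :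
    (spiralField a b c).IsPeriodicOrbit (loopSet a b c h₀ h₁ h₂ h₃ h₀) := by
  have p1 := Real.pi_pos.trans (pi_lt_arcTime_long h₀ h₁)
  have p2 := arcTime_short_pos h₁ h₂
  have p3 := Real.pi_pos.trans (pi_lt_arcTime_long (h₂ / 2) (h₃ / 2))
  have p4 := arcTime_short_pos h₃ h₀
  have m1 := fun t ht => H.arcR_mem (t := t) ht
  have m2 := fun t ht => H.arcLower_mem (t := t) ht
  have m3 := fun t ht => H.arcL_mem (t := t) ht
  have m4 := fun t ht => H.arcUpper_mem (t := t) ht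
  have e1 := H.arcR_end
  have e2 := H.arcLower_end
  have e3 := H.arcL_end
  have e4 := H.arcUpper_end
  generalize arcTime (2 * Real.pi) h₀ h₁ = T₁ at *
  generalize arcTime Real.pi h₁ h₂ = T₂ at *
  generalize arcTime (2 * Real.pi) (h₂ / 2) (h₃ / 2) = T₃ at *
  generalize arcTime Real.pi h₃ h₀ = T₄ at *
  have d1 : ∀ t, HasDerivAt (arcR a h₀) ((spiralField a b c).R (arcR a h₀ t)) t :=
    fun t => (isFocusChart_R a b c).hasDerivAt t _
  have d2 : ∀ t, HasDerivAt (arcLower b h₁) ((spiralField a b c).C (arcLower b h₁ t)) t :=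
    fun t => (isFocusChart_lower a b c).hasDerivAt t _
  have d3 : ∀ t, HasDerivAt (arcL c (h₂ / 2)) ((spiralField a b c).L (arcL c (h₂ / 2) t)) t :=
    fun t => (isFocusChart_L a b c).hasDerivAt t _
  have d4 : ∀ t, HasDerivAt (arcUpper b h₃) ((spiralField a b c).C (arcUpper b h₃ t)) t :=
    fun t => (isFocusChart_upper a b c).hasDerivAt t _
  have c1 : Continuous (arcR a h₀) := continuous_iff_continuousAt.2 fun t => (d1 t).continuousAt
  have c2 : Continuous (arcLower b h₁) :=
    continuous_iff_continuousAt.2 fun t => (d2 t).continuousAt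
  have c3 : Continuous (arcL c (h₂ / 2)) :=
    continuous_iff_continuousAt.2 fun t => (d3 t).continuousAt
  have c4 : Continuous (arcUpper b h₃) :=
    continuous_iff_continuousAt.2 fun t => (d4 t).continuousAt
  let g : ℝ → ℝ × ℝ := fun t => if t ≤ T₁ then arcR a h₀ t else
    if t ≤ T₁ + T₂ then arcLower b h₁ (t - T₁) else
    if t ≤ T₁ + T₂ + T₃ then arcL c (h₂ / 2) (t - (T₁ + T₂)) else
    arcUpper b h₃ (t - (T₁ + T₂ + T₃))
  have hg : Continuous g := by
    refine Continuous.if_le c1 (Continuous.if_le (by fun_prop) (Continuous.if_le (by fun_prop)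
      (by fun_prop) continuous_id continuous_const ?_) continuous_id continuous_const ?_)
      continuous_id continuous_const ?_
    · rintro t rfl; simp [e3, arcUpper_zero]
    · rintro t rfl; simp [e2, arcL_zero, p3.le]
    · rintro t rfl; simp [e1, arcLower_zero, p2.le]
  have g0 : g 0 = (1, h₀) := by simp only [g, if_pos p1.le, arcR_zero]
  have gT : g (T₁ + T₂ + T₃ + T₄) = (1, h₀) := by
    simp only [g]
    rw [if_neg (by linarith), if_neg (by linarith), if_neg (by linarith), add_sub_cancel_left, e4]
  obtain ⟨γ, hγ, hp, hr⟩ := ThreeZoneField.exists_periodic_solution (X := spiralField a b c)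
    (continuous_spiralField_L a b c) (continuous_spiralField_C a b c)
    (continuous_spiralField_R a b c) (T := T₁ + T₂ + T₃ + T₄) (by linarith) hg.continuousOn
    (g0.trans gT.symm) (N := {T₁, T₁ + T₂, T₁ + T₂ + T₃}) (by simp) (by
      intro t ht hN
      simp only [mem_insert_iff, mem_singleton_iff, not_or] at hN
      rcases lt_or_gt_of_ne hN.1 with h | h
      · have hev : g =ᶠ[𝓝 t] arcR a h₀ := by
          filter_upwards [Iio_mem_nhds h] with r hr
          simp only [g]; rw [if_pos (le_of_lt hr)]
        have hm := m1 t ⟨ht.1, h⟩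
        rw [hev.eq_of_nhds, ThreeZoneField.selection, if_neg (by linarith [hm.1]),
          if_neg (by linarith [hm.1])]
        exact (d1 t).congr_of_eventuallyEq hev
      rcases lt_or_gt_of_ne hN.2.1 with h' | h'
      · have hev : g =ᶠ[𝓝 t] fun r => arcLower b h₁ (r - T₁) := by
          filter_upwards [Ioo_mem_nhds h h'] with r hr
          simp only [g]; rw [if_neg hr.1.not_ge, if_pos hr.2.le]
        have hm := m2 (t - T₁) ⟨by linarith, by linarith⟩
        rw [hev.eq_of_nhds, ThreeZoneField.selection, if_neg (by linarith [hm.1]),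
          if_pos (by linarith [hm.2.1])]
        exact ((d2 (t - T₁)).comp_sub_const t T₁).congr_of_eventuallyEq hev
      rcases lt_or_gt_of_ne hN.2.2 with h'' | h''
      · have hev : g =ᶠ[𝓝 t] fun r => arcL c (h₂ / 2) (r - (T₁ + T₂)) := by
          filter_upwards [Ioo_mem_nhds h' h''] with r hr
          simp only [g]
          rw [if_neg (by linarith [hr.1]), if_neg hr.1.not_ge, if_pos hr.2.le]
        have hm := m3 (t - (T₁ + T₂)) ⟨by linarith, by linarith⟩
        rw [hev.eq_of_nhds, ThreeZoneField.selection, if_pos (by linarith [hm.1])]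
        exact ((d3 (t - (T₁ + T₂))).comp_sub_const t (T₁ + T₂)).congr_of_eventuallyEq hev
      · have hev : g =ᶠ[𝓝 t] fun r => arcUpper b h₃ (r - (T₁ + T₂ + T₃)) := by
          filter_upwards [Ioi_mem_nhds h''] with r hr
          rw [mem_Ioi] at hr
          simp only [g]
          rw [if_neg (by linarith), if_neg (by linarith), if_neg hr.not_ge]
        have hm := m4 (t - (T₁ + T₂ + T₃)) ⟨by linarith, by linarith [ht.2]⟩
        rw [hev.eq_of_nhds, ThreeZoneField.selection, if_neg (by linarith [hm.1]),
          if_pos (by linarith [hm.2.1])]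
        exact ((d4 (t - (T₁ + T₂ + T₃))).comp_sub_const t (T₁ + T₂ + T₃)).congr_of_eventuallyEq
          hev)
  obtain ⟨t₀, ht₀⟩ : (1, h₀) ∈ range γ := by
    rw [hr]; exact ⟨0, ⟨le_rfl, by linarith⟩, g0⟩
  have hrange := H.range_eq hγ (by linarith) hp ht₀
  refine ⟨γ, T₁ + T₂ + T₃ + T₄, by linarith, hγ, hp, ?_, hrange.symm⟩
  obtain ⟨t₁, ht₁⟩ : (-1, h₃) ∈ range γ := by
    rw [hr]
    refine ⟨T₁ + T₂ + T₃, ⟨by linarith, by linarith⟩, ?_⟩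
    simp only [g]
    rw [if_neg (by linarith), if_neg (by linarith), if_pos le_rfl, add_sub_cancel_left, e3]
  refine ⟨t₀, t₁, fun h => ?_⟩
  rw [ht₀, ht₁] at h
  have := congrArg Prod.fst h
  norm_num at this

theorem OrbitChain.isCrossing (H : OrbitChain η a b c h₀ h₁ h₂ h₃ h₄) :
    (spiralField a b c).IsCrossing (loopSet a b c h₀ h₁ h₂ h₃ h₄) := by
  have hη := H.eta_nonneg
  have hup : ∀ x y : ℝ, η < y → ((x = -1 → 0 < ((spiralField a b c).L (x, y)).1 *
      ((spiralField a b c).C (x, y)).1) ∧ (x = 1 → 0 < ((spiralField a b c).C (x, y)).1 *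
      ((spiralField a b c).R (x, y)).1)) := fun x y hy => by
    have := spiralField_crossing_fst H.abs_a H.abs_b H.abs_c (σ := 1) (Or.inl rfl) (z := (x, y))
      (by simpa using hy)
    simp only [one_mul] at this
    exact ⟨fun h => mul_pos (this.2 h).1 (this.2 h).2, fun h => mul_pos (this.1 h).1 (this.1 h).2⟩
  have hdown : ∀ x y : ℝ, η < y → ((x = -1 → 0 < ((spiralField a b c).L (x, -y)).1 *
      ((spiralField a b c).C (x, -y)).1) ∧ (x = 1 → 0 < ((spiralField a b c).C (x, -y)).1 *
      ((spiralField a b c).R (x, -y)).1)) := fun x y hy => by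
    have := spiralField_crossing_fst H.abs_a H.abs_b H.abs_c (σ := -1) (Or.inr rfl) (z := (x, -y))
      (by simpa using hy)
    simp only [neg_one_mul, neg_pos] at this
    exact ⟨fun h => mul_pos_of_neg_of_neg (this.2 h).1 (this.2 h).2,
      fun h => mul_pos_of_neg_of_neg (this.1 h).1 (this.1 h).2⟩
  intro z hz
  rcases H.loopSet_cases hz with h | h | h | rfl | rfl | rfl | rfl | rfl
  · exact ⟨fun e => by linarith [h.1], fun e => by linarith [h.1]⟩
  · exact ⟨fun e => by linarith [h.1], fun e => by linarith [h.2.1]⟩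
  · exact ⟨fun e => by linarith [h.1], fun e => by linarith [h.1]⟩
  · exact hup _ _ H.lt₀
  · exact hdown _ _ H.lt₁
  · exact hdown _ _ H.lt₂
  · exact hup _ _ H.lt₃
  · exact hup _ _ H.lt₄

theorem OrbitChain.visitsThreeZones (H : OrbitChain η a b c h₀ h₁ h₂ h₃ h₄) :
    VisitsThreeZones (loopSet a b c h₀ h₁ h₂ h₃ h₄) := by
  have p1 := Real.pi_pos.trans (pi_lt_arcTime_long h₀ h₁)
  have p2 := arcTime_short_pos h₁ h₂
  have p3 := Real.pi_pos.trans (pi_lt_arcTime_long (h₂ / 2) (h₃ / 2))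
  refine ⟨?_, ?_, ?_⟩
  · have ht : arcTime (2 * Real.pi) (h₂ / 2) (h₃ / 2) / 2 ∈
      Ioo 0 (arcTime (2 * Real.pi) (h₂ / 2) (h₃ / 2)) := ⟨by linarith, by linarith⟩
    exact ⟨_, Or.inl (Or.inr ⟨_, Ioo_subset_Icc_self ht, rfl⟩), (H.arcL_mem ht).1⟩
  · have ht : arcTime Real.pi h₁ h₂ / 2 ∈ Ioo 0 (arcTime Real.pi h₁ h₂) :=
      ⟨by linarith, by linarith⟩
    exact ⟨_, Or.inl (Or.inl (Or.inr ⟨_, Ioo_subset_Icc_self ht, rfl⟩)),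
      (H.arcLower_mem ht).1, (H.arcLower_mem ht).2.1⟩
  · have ht : arcTime (2 * Real.pi) h₀ h₁ / 2 ∈ Ioo 0 (arcTime (2 * Real.pi) h₀ h₁) :=
      ⟨by linarith, by linarith⟩
    exact ⟨_, Or.inl (Or.inl (Or.inl ⟨_, Ioo_subset_Icc_self ht, rfl⟩)), (H.arcR_mem ht).1⟩

end Closed

/-! ### Isolation of closed orbits -/

section Isolation

variable {η a b c l r : ℝ} {γ : ℝ → ℝ × ℝ}

/-- A closed set that cuts the plane so that every solution in its complement runs around the three
foci and meets the half-line `x = 1`, `y > 0` in the segment `l < y < r`: segments that join the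
three foci, neighbourhoods of the tangency points, and the rest of the half-line. -/
def barrier (η l r : ℝ) : Set (ℝ × ℝ) :=
  {z | z.2 = 0 ∧ -1 ≤ z.1 ∧ z.1 ≤ 2} ∪ {z | z.1 + 2 * z.2 + 1 = 0 ∧ -5 ≤ z.1 ∧ z.1 ≤ -1} ∪
  {z | (z.1 = 1 ∨ z.1 = -1) ∧ |z.2| ≤ η} ∪ {z | z.1 = 1 ∧ 0 ≤ z.2 ∧ (z.2 ≤ l ∨ r ≤ z.2)}

theorem isClosed_barrier (η l r : ℝ) : IsClosed (barrier η l r) := by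
  have h1 : Continuous fun z : ℝ × ℝ => z.1 := continuous_fst
  have h2 : Continuous fun z : ℝ × ℝ => z.2 := continuous_snd
  refine ((IsClosed.union ?_ ?_).union ?_).union ?_
  · exact (isClosed_eq h2 continuous_const).inter
      ((isClosed_le continuous_const h1).inter (isClosed_le h1 continuous_const))
  · exact (isClosed_eq (by fun_prop) continuous_const).inter
      ((isClosed_le continuous_const h1).inter (isClosed_le h1 continuous_const))
  · exact ((isClosed_eq h1 continuous_const).union (isClosed_eq h1 continuous_const)).inter
      (isClosed_le h2.abs continuous_const)
  · exact (isClosed_eq h1 continuous_const).inter ((isClosed_le continuous_const h2).inter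
      ((isClosed_le h2 continuous_const).union (isClosed_le continuous_const h2)))

theorem snd_ne_zero_of_notMem_barrier {z : ℝ × ℝ} (h : z ∉ barrier η l r) (h1 : -1 ≤ z.1)
    (h2 : z.1 ≤ 2) : z.2 ≠ 0 := fun h0 => h (Or.inl (Or.inl (Or.inl ⟨h0, h1, h2⟩)))

theorem lt_abs_snd_of_notMem_barrier {z : ℝ × ℝ} (h : z ∉ barrier η l r)
    (hx : z.1 = 1 ∨ z.1 = -1) : η < |z.2| := by
  by_contra! h'
  exact h (Or.inl (Or.inr ⟨hx, h'⟩))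

theorem mem_Ioo_of_notMem_barrier {z : ℝ × ℝ} (h : z ∉ barrier η l r) (hx : z.1 = 1)
    (hy : 0 < z.2) : z.2 ∈ Ioo l r := by
  by_contra h'
  refine h (Or.inr ⟨hx, hy.le, ?_⟩)
  by_contra! h''
  exact h' h''

/-- Every orbit of a focus meets the half-line `w = 0`, `u ≤ 0`. -/
theorem exists_focusFlow_left (a : ℝ) (q : ℝ × ℝ) :
    ∃ t ≥ 0, (focusFlow a t q).2 = 0 ∧ (focusFlow a t q).1 ≤ 0 := by
  have hE := Real.exp_pos (a * Real.pi)
  have hpi := focusFlow_add_pi a 0 q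
  rw [zero_add, focusFlow_zero] at hpi
  have h0 : (0 : ℝ) ∈ uIcc (focusFlow a 0 q).2 (focusFlow a Real.pi q).2 := by
    rw [hpi, focusFlow_zero, mem_uIcc]
    simp only [Prod.smul_snd, smul_eq_mul]
    rcases le_total 0 q.2 with h | h
    · exact Or.inr ⟨by nlinarith, h⟩
    · exact Or.inl ⟨h, by nlinarith⟩
  obtain ⟨t, ht, e⟩ := intermediate_value_uIcc (continuous_focusFlow a q).snd.continuousOn h0
  rw [uIcc_of_le Real.pi_pos.le] at ht
  dsimp only at e
  rcases le_total (focusFlow a t q).1 0 with h | h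
  · exact ⟨t, ht.1, e, h⟩
  · refine ⟨t + Real.pi, by linarith [ht.1, Real.pi_pos], ?_, ?_⟩ <;> rw [focusFlow_add_pi] <;>
      simp only [Prod.smul_snd, Prod.smul_fst, smul_eq_mul]
    · rw [e, mul_zero]
    · nlinarith

variable (ha : |a| ≤ η) (hb : |b| ≤ η) (hc : |c| ≤ η / 2)
  (hγ : (spiralField a b c).IsSolution γ) (hU : ∀ t, γ t ∉ barrier η l r)
include ha hb hc hγ hU

theorem exists_crossing_up_of_pos {t : ℝ} (hx : (γ t).1 = 1 ∨ (γ t).1 = -1) (hy : 0 < (γ t).2) :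
    ∃ δ > 0, ∀ r t', t - δ < r → r < t' → t' < t + δ → (γ r).1 < (γ t').1 := by
  refine exists_crossing_up ha hb hc hγ hx ?_
  have := lt_abs_snd_of_notMem_barrier (hU t) hx
  rwa [abs_of_pos hy] at this

theorem exists_crossing_down_of_neg {t : ℝ} (hx : (γ t).1 = 1 ∨ (γ t).1 = -1)
    (hy : (γ t).2 < 0) :
    ∃ δ > 0, ∀ r t', t - δ < r → r < t' → t' < t + δ → (γ t').1 < (γ r).1 := by
  refine exists_crossing_down ha hb hc hγ hx ?_
  have := lt_abs_snd_of_notMem_barrier (hU t) hx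
  rw [abs_of_neg hy] at this
  linarith

theorem exists_exit_upper {s : ℝ} (h1 : -1 < (γ s).1) (h2 : (γ s).1 < 1) (h3 : 0 < (γ s).2) :
    ∃ t ≥ s, (γ t).1 = 1 ∧ 0 < (γ t).2 := by
  let A : Set (ℝ × ℝ) := zoneC ∩ {z | 0 < z.2}
  have hA : IsOpen A := isOpen_zoneC.inter (isOpen_lt continuous_const continuous_snd)
  rcases hγ.continuous.forall_mem_or_exists_exit hA (s := s) ⟨⟨h1, h2⟩, h3⟩ with h | h
  · have := hγ.eq_focusFlow (continuous_spiralField_C a b c)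
      (fun z hz => ThreeZoneField.filippov_of_mem hz.1 hz.2) (isFocusChart_upper a b c)
      (s := s) (t := s + Real.pi) (fun τ hτ => (h τ hτ.1.le).1)
      (right_mem_Icc.2 (by linarith [Real.pi_pos]))
    have hpi := focusFlow_add_pi b 0 (γ s)
    rw [zero_add, focusFlow_zero] at hpi
    simp only [add_sub_cancel_left, zero_add, sub_zero, ContinuousLinearEquiv.refl_symm,
      ContinuousLinearEquiv.refl_apply, hpi] at this
    have hlt : 0 < (γ (s + Real.pi)).2 := (h _ (by linarith [Real.pi_pos])).2
    rw [this] at hlt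
    simp only [Prod.smul_snd, smul_eq_mul] at hlt
    nlinarith [Real.exp_pos (b * Real.pi)]
  · obtain ⟨t, hst, hin, hcl, hnot⟩ := h
    have hclA : closure A ⊆ {z | -1 ≤ z.1 ∧ z.1 ≤ 1 ∧ 0 ≤ z.2} := by
      refine closure_minimal (fun z hz => ⟨hz.1.1.le, hz.1.2.le, le_of_lt hz.2⟩) ?_
      exact (isClosed_le continuous_const continuous_fst).inter
        ((isClosed_le continuous_fst continuous_const).inter
          (isClosed_le continuous_const continuous_snd))
    obtain ⟨g1, g2, g3⟩ := hclA hcl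
    have hy : 0 < (γ t).2 := lt_of_le_of_ne g3
      (snd_ne_zero_of_notMem_barrier (hU t) g1 (by linarith)).symm
    rcases g2.eq_or_lt with hx | hx
    · exact ⟨t, hst.le, hx, hy⟩
    rcases g1.eq_or_lt with hx' | hx'
    · exfalso
      obtain ⟨δ, hδ, hm⟩ := exists_crossing_up_of_pos ha hb hc hγ hU (Or.inr hx'.symm) hy
      obtain ⟨τ, hτ, hτt⟩ := exists_between (max_lt hst (sub_lt_self t hδ))
      rw [max_lt_iff] at hτ
      have e1 := hm τ t hτ.2 hτt (by linarith)
      have e2 := (hin τ ⟨hτ.1.le, hτt⟩).1.1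
      linarith
    · exact absurd ⟨⟨hx', hx⟩, hy⟩ hnot

theorem exists_exit_lower {s : ℝ} (h1 : -1 < (γ s).1) (h2 : (γ s).1 < 1) (h3 : (γ s).2 < 0) :
    ∃ t ≥ s, (γ t).1 = -1 ∧ (γ t).2 < 0 := by
  let A : Set (ℝ × ℝ) := zoneC ∩ {z | z.2 < 0}
  have hA : IsOpen A := isOpen_zoneC.inter (isOpen_lt continuous_snd continuous_const)
  rcases hγ.continuous.forall_mem_or_exists_exit hA (s := s) ⟨⟨h1, h2⟩, h3⟩ with h | h
  · have := hγ.eq_focusFlow (continuous_spiralField_C a b c)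
      (fun z hz => ThreeZoneField.filippov_of_mem hz.1 hz.2) (isFocusChart_upper a b c)
      (s := s) (t := s + Real.pi) (fun τ hτ => (h τ hτ.1.le).1)
      (right_mem_Icc.2 (by linarith [Real.pi_pos]))
    have hpi := focusFlow_add_pi b 0 (γ s)
    rw [zero_add, focusFlow_zero] at hpi
    simp only [add_sub_cancel_left, zero_add, sub_zero, ContinuousLinearEquiv.refl_symm,
      ContinuousLinearEquiv.refl_apply, hpi] at this
    have hlt : (γ (s + Real.pi)).2 < 0 := (h _ (by linarith [Real.pi_pos])).2
    rw [this] at hlt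
    simp only [Prod.smul_snd, smul_eq_mul] at hlt
    nlinarith [Real.exp_pos (b * Real.pi)]
  · obtain ⟨t, hst, hin, hcl, hnot⟩ := h
    have hclA : closure A ⊆ {z | -1 ≤ z.1 ∧ z.1 ≤ 1 ∧ z.2 ≤ 0} := by
      refine closure_minimal (fun z hz => ⟨hz.1.1.le, hz.1.2.le, le_of_lt hz.2⟩) ?_
      exact (isClosed_le continuous_const continuous_fst).inter
        ((isClosed_le continuous_fst continuous_const).inter
          (isClosed_le continuous_snd continuous_const))
    obtain ⟨g1, g2, g3⟩ := hclA hcl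
    have hy : (γ t).2 < 0 := lt_of_le_of_ne g3
      (snd_ne_zero_of_notMem_barrier (hU t) g1 (by linarith))
    rcases g1.eq_or_lt with hx | hx
    · exact ⟨t, hst.le, hx.symm, hy⟩
    rcases g2.eq_or_lt with hx' | hx'
    · exfalso
      obtain ⟨δ, hδ, hm⟩ := exists_crossing_down_of_neg ha hb hc hγ hU (Or.inl hx') hy
      obtain ⟨τ, hτ, hτt⟩ := exists_between (max_lt hst (sub_lt_self t hδ))
      rw [max_lt_iff] at hτ
      have e1 := hm τ t hτ.2 hτt (by linarith)
      have e2 := (hin τ ⟨hτ.1.le, hτt⟩).1.2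
      linarith
    · exact absurd ⟨⟨hx, hx'⟩, hy⟩ hnot

theorem exists_exit_right {s : ℝ} (h1 : 1 < (γ s).1) : ∃ t ≥ s, (γ t).1 = 1 ∧ (γ t).2 < 0 := by
  rcases hγ.continuous.forall_mem_or_exists_exit isOpen_zoneR (s := s) h1 with h | h
  · exfalso
    obtain ⟨τ, hτ, hw, hu⟩ := exists_focusFlow_left a (γ s - (2, 0))
    have := hγ.eq_focusFlow (continuous_spiralField_R a b c)
      (fun z hz => ThreeZoneField.filippov_of_gt hz) (isFocusChart_R a b c)
      (s := s) (t := s + τ) (fun τ hτ => h τ hτ.1.le) (right_mem_Icc.2 (by linarith))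
    simp only [add_sub_cancel_left, ContinuousLinearEquiv.refl_symm,
      ContinuousLinearEquiv.refl_apply] at this
    have hx : 1 < (γ (s + τ)).1 := h _ (by linarith)
    refine snd_ne_zero_of_notMem_barrier (hU (s + τ)) (by linarith) ?_ ?_
    · rw [this, Prod.fst_add]; dsimp only; linarith
    · rw [this, Prod.snd_add, hw]; norm_num
  · obtain ⟨t, hst, hin, hcl, hnot⟩ := h
    have hclA : closure zoneR ⊆ {z | 1 ≤ z.1} := closure_minimal
      (fun z hz => (show 1 < z.1 from hz).le)
      (isClosed_le continuous_const continuous_fst)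
    have hx : (γ t).1 = 1 := le_antisymm (not_lt.1 hnot) (hclA hcl)
    refine ⟨t, hst.le, hx, ?_⟩
    have hne := snd_ne_zero_of_notMem_barrier (hU t) (by linarith) (by linarith)
    by_contra! hy
    obtain ⟨δ, hδ, hm⟩ := exists_crossing_up_of_pos ha hb hc hγ hU (Or.inl hx)
      (lt_of_le_of_ne hy hne.symm)
    obtain ⟨τ, hτ, hτt⟩ := exists_between (max_lt hst (sub_lt_self t hδ))
    rw [max_lt_iff] at hτ
    have e1 := hm τ t hτ.2 hτt (by linarith)
    have e2 : 1 < (γ τ).1 := hin τ ⟨hτ.1.le, hτt⟩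
    linarith

theorem exists_exit_left {s : ℝ} (h1 : (γ s).1 < -1) : ∃ t ≥ s, (γ t).1 = -1 ∧ 0 < (γ t).2 := by
  rcases hγ.continuous.forall_mem_or_exists_exit isOpen_zoneL (s := s) h1 with h | h
  · exfalso
    obtain ⟨τ, hτ, hw, hu⟩ := exists_focusFlow_left c (leftChart.symm (γ s - (-5, 2)))
    have := hγ.eq_focusFlow (continuous_spiralField_L a b c)
      (fun z hz => ThreeZoneField.filippov_of_lt hz) (isFocusChart_L a b c)
      (s := s) (t := s + τ) (fun τ hτ => h τ hτ.1.le) (right_mem_Icc.2 (by linarith))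
    simp only [add_sub_cancel_left, leftChart_apply, hw] at this
    have hx : (γ (s + τ)).1 < -1 := h _ (by linarith)
    refine hU (s + τ) (Or.inl (Or.inl (Or.inr ⟨?_, ?_, hx.le⟩)))
    · rw [this, Prod.fst_add, Prod.snd_add]; dsimp only; ring
    · rw [this, Prod.fst_add]; dsimp only; linarith
  · obtain ⟨t, hst, hin, hcl, hnot⟩ := h
    have hclA : closure zoneL ⊆ {z | z.1 ≤ -1} := closure_minimal
      (fun z hz => (show z.1 < -1 from hz).le)
      (isClosed_le continuous_fst continuous_const)
    have hx : (γ t).1 = -1 := le_antisymm (hclA hcl) (not_lt.1 hnot)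
    refine ⟨t, hst.le, hx, ?_⟩
    have hne := snd_ne_zero_of_notMem_barrier (hU t) (by linarith) (by linarith)
    by_contra! hy
    obtain ⟨δ, hδ, hm⟩ := exists_crossing_down_of_neg ha hb hc hγ hU (Or.inr hx)
      (lt_of_le_of_ne hy hne)
    obtain ⟨τ, hτ, hτt⟩ := exists_between (max_lt hst (sub_lt_self t hδ))
    rw [max_lt_iff] at hτ
    have e1 := hm τ t hτ.2 hτt (by linarith)
    have e2 : (γ τ).1 < -1 := hin τ ⟨hτ.1.le, hτt⟩
    linarith

/-- A solution outside the barrier passes through the four regions in cyclic order, so that it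
meets the half-line `x = 1`, `y > 0`. -/
theorem exists_mem_section : ∃ t, (γ t).1 = 1 ∧ 0 < (γ t).2 := by
  have hcont := hγ.continuous
  have hnear : ∀ (P : ℝ × ℝ → Prop) (s δ : ℝ), 0 < δ → (∀ᶠ z in 𝓝 (γ s), P z) →
      ∃ t > s, t < s + δ ∧ P (γ t) := by
    intro P s δ hδ hP
    have h1 : ∀ᶠ t in 𝓝[>] s, P (γ t) := (hcont.continuousAt.eventually hP).filter_mono
      nhdsWithin_le_nhds
    obtain ⟨t, hPt, ht⟩ := (h1.and (Ioo_mem_nhdsGT (show s < s + δ by linarith))).exists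
    exact ⟨t, ht.1, ht.2, hPt⟩
  have hup : ∀ s, -1 ≤ (γ s).1 → (γ s).1 < 1 → 0 < (γ s).2 →
      ∃ t, (γ t).1 = 1 ∧ 0 < (γ t).2 := by
    intro s h1 h2 h3
    rcases h1.eq_or_lt with h1 | h1
    · obtain ⟨δ, hδ, hm⟩ := exists_crossing_up_of_pos ha hb hc hγ hU (Or.inr h1.symm) h3
      obtain ⟨t, ht, htδ, hx, hy⟩ := hnear (fun z => z.1 < 1 ∧ 0 < z.2) s δ hδ
        ((continuous_fst.continuousAt.eventually_lt_const h2).and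
          (continuous_snd.continuousAt.eventually_const_lt h3))
      have := hm s t (by linarith) ht htδ
      obtain ⟨t', -, h⟩ := exists_exit_upper ha hb hc hγ hU (s := t) (by linarith) hx hy
      exact ⟨t', h⟩
    · obtain ⟨t', -, h⟩ := exists_exit_upper ha hb hc hγ hU h1 h2 h3
      exact ⟨t', h⟩
  have hleft : ∀ s, (γ s).1 < -1 → ∃ t, (γ t).1 = 1 ∧ 0 < (γ t).2 := by
    intro s h1
    obtain ⟨t, -, hx, hy⟩ := exists_exit_left ha hb hc hγ hU h1
    exact hup t hx.ge (by linarith) hy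
  have hlow : ∀ s, -1 < (γ s).1 → (γ s).1 ≤ 1 → (γ s).2 < 0 →
      ∃ t, (γ t).1 = 1 ∧ 0 < (γ t).2 := by
    have key : ∀ s, -1 < (γ s).1 → (γ s).1 < 1 → (γ s).2 < 0 →
        ∃ t, (γ t).1 = 1 ∧ 0 < (γ t).2 := by
      intro s h1 h2 h3
      obtain ⟨t, -, hx, hy⟩ := exists_exit_lower ha hb hc hγ hU h1 h2 h3
      obtain ⟨δ, hδ, hm⟩ := exists_crossing_down_of_neg ha hb hc hγ hU (Or.inr hx) hy
      have := hm t (t + δ / 2) (by linarith) (by linarith) (by linarith)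
      exact hleft (t + δ / 2) (by linarith)
    intro s h1 h2 h3
    rcases h2.eq_or_lt with h2 | h2
    · obtain ⟨δ, hδ, hm⟩ := exists_crossing_down_of_neg ha hb hc hγ hU (Or.inl h2) h3
      obtain ⟨t, ht, htδ, hx, hy⟩ := hnear (fun z => -1 < z.1 ∧ z.2 < 0) s δ hδ
        ((continuous_fst.continuousAt.eventually_const_lt h1).and
          (continuous_snd.continuousAt.eventually_lt_const h3))
      have := hm s t (by linarith) ht htδ
      exact key t hx (by linarith) hy
    · exact key s h1 h2 h3
  rcases lt_or_ge (γ 0).1 (-1) with h | h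
  · exact hleft 0 h
  rcases lt_or_ge 1 (γ 0).1 with h' | h'
  · obtain ⟨t, -, hx, hy⟩ := exists_exit_right ha hb hc hγ hU h'
    exact hlow t (by linarith) hx.le hy
  rcases lt_or_gt_of_ne (snd_ne_zero_of_notMem_barrier (hU 0) h (by linarith)) with hy | hy
  · rcases h.eq_or_lt with h | h
    · obtain ⟨δ, hδ, hm⟩ := exists_crossing_down_of_neg ha hb hc hγ hU (Or.inr h.symm) hy
      have := hm 0 (δ / 2) (by linarith) (by linarith) (by linarith)
      exact hleft (δ / 2) (by linarith)
    · exact hlow 0 h h' hy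
  · rcases h'.eq_or_lt with h' | h'
    · exact ⟨0, h', hy⟩
    · exact hup 0 h h' hy

end Isolation

theorem OrbitChain.lt_of_lt {η a b c h₀ h₁ h₂ h₃ h₄ k₀ k₁ k₂ k₃ k₄ : ℝ}
    (H : OrbitChain η a b c h₀ h₁ h₂ h₃ h₄) (K : OrbitChain η a b c k₀ k₁ k₂ k₃ k₄)
    (h : h₀ < k₀) : h₄ < k₄ := by
  have e1 := (FocusStep.lt_iff (H.abs_a.trans H.lt₀.le) (H.abs_a.trans H.lt₁.le)
    (K.abs_a.trans K.lt₀.le) (K.abs_a.trans K.lt₁.le) H.right K.right).2 h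
  have e2 := (FocusStep.lt_iff (H.abs_b.trans H.lt₁.le) (H.abs_b.trans H.lt₂.le)
    (K.abs_b.trans K.lt₁.le) (K.abs_b.trans K.lt₂.le) H.lower K.lower).2 e1
  have e3 := (FocusStep.lt_iff (H.abs_c.trans (by linarith [H.lt₂]))
    (H.abs_c.trans (by linarith [H.lt₃])) (K.abs_c.trans (by linarith [K.lt₂]))
    (K.abs_c.trans (by linarith [K.lt₃])) H.left K.left).2 (by linarith)
  exact (FocusStep.lt_iff (H.abs_b.trans H.lt₃.le) (H.abs_b.trans H.lt₄.le)
    (K.abs_b.trans K.lt₃.le) (K.abs_b.trans K.lt₄.le) H.upper K.upper).2 (by linarith)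

/-- An isolated fixed point of the return map `P` gives a limit cycle. -/
theorem isLimitCycle_of_isolated {η a b c l r : ℝ} {P₁ P₂ P₃ P : ℝ → ℝ}
    (hP : ∀ y ∈ Ioo l r, OrbitChain η a b c y (P₁ y) (P₂ y) (P₃ y) (P y))
    {y₀ : ℝ} (hy₀ : y₀ ∈ Ioo l r) (hfix : P y₀ = y₀) (hiso : ∀ y ∈ Ioo l r, P y = y → y = y₀) :
    (spiralField a b c).IsLimitCycle (loopSet a b c y₀ (P₁ y₀) (P₂ y₀) (P₃ y₀) y₀) := by
  have H := hP y₀ hy₀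
  have hη := H.eta_nonneg
  rw [hfix] at H
  have hmono : ∀ y ∈ Ioo l r, ∀ y' ∈ Ioo l r, y < y' → P y < P y' := fun y hy y' hy' h =>
    (hP y hy).lt_of_lt (hP y' hy') h
  refine ⟨H.isPeriodicOrbit, (barrier η l r)ᶜ, (isClosed_barrier η l r).isOpen_compl, ?_, ?_⟩
  · intro z hz
    have hlt : ∀ {y : ℝ}, η < y → ¬ |y| ≤ η := fun h => by
      rw [abs_of_pos (hη.trans_lt h)]; exact h.not_ge
    have hlt' : ∀ {y : ℝ}, η < y → ¬ |-y| ≤ η := fun h => by rw [abs_neg]; exact hlt h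
    have p0 := hη.trans_lt H.lt₀
    have p1 := hη.trans_lt H.lt₁
    have p2 := hη.trans_lt H.lt₂
    have p3 := hη.trans_lt H.lt₃
    rcases H.loopSet_cases hz with h | h | h | rfl | rfl | rfl | rfl | rfl <;>
      rintro (((g | g) | g) | g)
    · linarith [h.2 g.1, g.2.2]
    · linarith [h.1, g.2.2]
    · rcases g.1 with g | g <;> linarith [h.1]
    · linarith [h.1, g.1]
    · exact h.2.2 g.1
    · linarith [h.1, g.2.2]
    · rcases g.1 with g | g <;> linarith [h.1, h.2.1]
    · linarith [h.2.1, g.1]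
    · linarith [h.1, g.2.1]
    · linarith [h.2 g.1, g.2.1]
    · rcases g.1 with g | g <;> linarith [h.1]
    · linarith [h.1, g.1]
    · exact p0.ne' g.1
    · norm_num at g
    · exact hlt H.lt₀ g.2
    · rcases g.2.2 with g | g <;> dsimp only at g <;> linarith [hy₀.1, hy₀.2]
    · have := g.1; dsimp only at this; linarith
    · norm_num at g
    · exact hlt' H.lt₁ g.2
    · have := g.2.1; dsimp only at this; linarith
    · have := g.1; dsimp only at this; linarith
    · have := g.1; dsimp only at this; linarith
    · exact hlt' H.lt₂ g.2
    · norm_num at g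
    · exact p3.ne' g.1
    · have := g.1; dsimp only at this; linarith
    · exact hlt H.lt₃ g.2
    · norm_num at g
    · exact p0.ne' g.1
    · norm_num at g
    · exact hlt H.lt₀ g.2
    · rcases g.2.2 with g | g <;> dsimp only at g <;> linarith [hy₀.1, hy₀.2]
  · rintro Γ' ⟨γ, T, hT, hγ, hp, -, rfl⟩ hsub
    have hU : ∀ t, γ t ∉ barrier η l r := fun t => hsub (mem_range_self t)
    obtain ⟨t₀, hx, hy⟩ := exists_mem_section H.abs_a H.abs_b H.abs_c hγ hU
    set y := (γ t₀).2 with hydef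
    have hyI : y ∈ Ioo l r := mem_Ioo_of_notMem_barrier (hU t₀) hx hy
    have h0 : γ t₀ = (1, y) := Prod.ext hx rfl
    -- the successive intersections with the half-line are the iterates of the return map
    let Y : ℕ → ℝ := fun n => P^[n] y
    have hYs : ∀ n, Y (n + 1) = P (Y n) := fun n => Function.iterate_succ_apply' P n y
    let L : ℕ → ℝ := fun n => loopTime (Y n) (P₁ (Y n)) (P₂ (Y n)) (P₃ (Y n)) (P (Y n))
    let τ : ℕ → ℝ := fun n => t₀ + ∑ i ∈ Finset.range n, L i
    have hτs : ∀ n, τ (n + 1) = τ n + L n := fun n => by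
      simp only [τ, Finset.sum_range_succ, add_assoc]
    have hY : ∀ n, Y n ∈ Ioo l r ∧ γ (τ n) = (1, Y n) := by
      intro n
      induction n with
      | zero => exact ⟨hyI, by simpa [τ, Y] using h0⟩
      | succ n ih =>
        have hch := hP _ ih.1
        have hf := (hch.follow hγ ih.2).1
        have e : γ (τ (n + 1)) = (1, Y (n + 1)) := by rw [hτs, hYs]; exact hf
        refine ⟨?_, e⟩
        have := mem_Ioo_of_notMem_barrier (hU (τ (n + 1))) (by rw [e])
          (by rw [e, hYs]; exact hη.trans_lt hch.lt₄)
        rwa [e] at this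
    have hret : P y = y := by
      by_contra hne
      have hτge : ∀ n : ℕ, t₀ + n * Real.pi ≤ τ n := by
        intro n
        induction n with
        | zero => simp [τ]
        | succ n ih =>
          rw [hτs]; push_cast
          have : Real.pi < L n := pi_lt_loopTime _ _ _ _ _
          linarith
      have hex : ∃ n, t₀ + T < τ n := by
        obtain ⟨n, hn⟩ := exists_nat_gt (T / Real.pi)
        rw [div_lt_iff₀ Real.pi_pos] at hn
        exact ⟨n, by linarith [hτge n]⟩
      -- the first return after one period happens at some `τ n` with `n ≥ 1`
      classical
      obtain ⟨n, hn⟩ : ∃ n, Nat.find hex = n + 1 :=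
        Nat.exists_eq_succ_of_ne_zero fun h => by
          have := Nat.find_spec hex
          rw [h] at this
          simp only [τ, Finset.range_zero, Finset.sum_empty] at this
          linarith
      have hlt : t₀ + T < τ n + L n := by rw [← hτs, ← hn]; exact Nat.find_spec hex
      have hge : τ n ≤ t₀ + T := not_lt.1 (Nat.find_min hex (by omega))
      have heq : τ n = t₀ + T := by
        rcases hge.eq_or_lt with h | h
        · exact h
        · refine absurd ?_ (((hP _ (hY n).1).follow hγ (hY n).2).2.1 (t₀ + T) ⟨h, hlt⟩)
          rw [hp t₀]; exact ⟨hx, hy⟩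
      have hYn : Y n = y := by
        have := (hY n).2
        rw [heq, hp t₀, h0] at this
        exact (congrArg Prod.snd this).symm
      have hn0 : 0 < n := by
        rcases Nat.eq_zero_or_pos n with h | h
        · rw [h] at heq
          simp only [τ, Finset.range_zero, Finset.sum_empty] at heq
          linarith
        · exact h
      rcases lt_or_gt_of_ne hne with h | h
      · have : StrictAnti Y := strictAnti_nat_of_succ_lt fun n => by
          induction n with
          | zero => exact h
          | succ n ih =>
            rw [hYs (n + 1), hYs n]
            have := hmono _ (hY (n + 1)).1 _ (hY n).1 ih
            rwa [hYs n] at this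
        exact (this hn0).ne hYn
      · have : StrictMono Y := strictMono_nat_of_lt_succ fun n => by
          induction n with
          | zero => exact h
          | succ n ih =>
            rw [hYs (n + 1), hYs n]
            have := hmono _ (hY n).1 _ (hY (n + 1)).1 ih
            rwa [hYs n] at this
        exact (this hn0).ne' hYn
    have hyy := hiso y hyI hret
    rw [hyy] at h0
    exact H.range_eq hγ hT hp h0

/-! ### The periodic annulus of the unperturbed system -/

theorem orbitChain_zero {h : ℝ} (hh : 0 < h) : OrbitChain (h / 2) 0 0 0 h h h h h := by
  have : h / 2 < h := by linarith
  refine ⟨?_, ?_, ?_, this, this, this, this, this, focusStep_zero _ _, focusStep_zero _ _,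
    focusStep_zero _ _, focusStep_zero _ _⟩ <;> rw [abs_zero] <;> positivity

theorem loopSet_zero_eq_annulusCurve {h : ℝ} (hh : 0 < h) : loopSet 0 0 0 h h h h h =
    (ThreeZoneHam.normalForm 1 2 (-1) (-3) 0 1 (-1) 2).annulusCurve h := by
  have H := orbitChain_zero hh
  have hR : {z : ℝ × ℝ | (ThreeZoneHam.normalForm 1 2 (-1) (-3) 0 1 (-1) 2).R.val z =
      (ThreeZoneHam.normalForm 1 2 (-1) (-3) 0 1 (-1) 2).R.val (1, h) ∧ 1 < z.1} =
      arcR 0 h '' Ioo 0 (arcTime (2 * Real.pi) h h) := by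
    have e : arcR 0 h = (fun z => (2 + z.1, z.2)) ∘ fun t => focusFlow 0 t (-1, h) :=
      funext fun t => arcR_eq 0 h t
    rw [e, image_comp, ← long_circle hh]
    ext ⟨x, y⟩
    simp only [ThreeZoneHam.normalForm, QuadHam.val, mem_ofPred_eq, mem_image, Prod.exists,
      Prod.mk.injEq]
    constructor
    · rintro ⟨h1, h2⟩
      exact ⟨x - 2, y, ⟨by linear_combination 2 * h1, by linarith⟩, by ring, rfl⟩
    · rintro ⟨u, w, ⟨h1, h2⟩, rfl, rfl⟩
      exact ⟨by linear_combination h1 / 2, by linarith⟩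
  have hL : {z : ℝ × ℝ | (ThreeZoneHam.normalForm 1 2 (-1) (-3) 0 1 (-1) 2).L.val z =
      (ThreeZoneHam.normalForm 1 2 (-1) (-3) 0 1 (-1) 2).L.val (-1, -h) ∧ z.1 < -1} =
      arcL 0 (h / 2) '' Ioo 0 (arcTime (2 * Real.pi) (h / 2) (h / 2)) := by
    have e : arcL 0 (h / 2) = (fun z => (-5 - 4 * z.1, 2 + 2 * z.1 - 2 * z.2)) ∘
      fun t => focusFlow 0 t (-1, h / 2) := funext fun t => arcL_eq 0 (h / 2) t
    rw [e, image_comp, ← long_circle (half_pos hh)]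
    ext ⟨x, y⟩
    simp only [ThreeZoneHam.normalForm, QuadHam.val, mem_ofPred_eq, mem_image, Prod.exists,
      Prod.mk.injEq]
    constructor
    · rintro ⟨h1, h2⟩
      exact ⟨(-5 - x) / 4, (-1 - x) / 4 - y / 2, ⟨by linear_combination h1 / 4, by linarith⟩,
        by ring, by ring⟩
    · rintro ⟨u, w, ⟨h1, h2⟩, rfl, rfl⟩
      exact ⟨by linear_combination 4 * h1, by linarith⟩
  have hlow : {z : ℝ × ℝ | (ThreeZoneHam.normalForm 1 2 (-1) (-3) 0 1 (-1) 2).C.val z =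
      (ThreeZoneHam.normalForm 1 2 (-1) (-3) 0 1 (-1) 2).C.val (1, -h) ∧ -1 ≤ z.1 ∧ z.1 ≤ 1 ∧
      z.2 < 0} = arcLower 0 h '' Icc 0 (arcTime Real.pi h h) := by
    have e : arcLower 0 h = (fun z => (-z.1, -z.2)) ∘ fun t => focusFlow 0 t (-1, h) :=
      funext fun t => arcLower_eq 0 h t
    rw [e, image_comp, ← short_circle hh]
    ext ⟨x, y⟩
    simp only [ThreeZoneHam.normalForm, QuadHam.val, mem_ofPred_eq, mem_image, Prod.exists,
      Prod.mk.injEq]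
    constructor
    · rintro ⟨h1, h2, h3, h4⟩
      exact ⟨-x, -y, ⟨by linear_combination 2 * h1, by linarith, by linarith, by linarith⟩,
        by ring, by ring⟩
    · rintro ⟨u, w, ⟨h1, h2, h3, h4⟩, rfl, rfl⟩
      exact ⟨by linear_combination h1 / 2, by linarith, by linarith, by linarith⟩
  have hup : {z : ℝ × ℝ | (ThreeZoneHam.normalForm 1 2 (-1) (-3) 0 1 (-1) 2).C.val z =
      (ThreeZoneHam.normalForm 1 2 (-1) (-3) 0 1 (-1) 2).C.val (-1, h) ∧ -1 ≤ z.1 ∧ z.1 ≤ 1 ∧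
      0 < z.2} = arcUpper 0 h '' Icc 0 (arcTime Real.pi h h) := by
    have e : arcUpper 0 h = fun t => focusFlow 0 t (-1, h) := funext fun t => arcUpper_eq 0 h t
    rw [e, ← short_circle hh]
    ext ⟨x, y⟩
    simp only [ThreeZoneHam.normalForm, QuadHam.val, mem_ofPred_eq]
    refine and_congr_left fun _ => ⟨fun h1 => by linear_combination 2 * h1,
      fun h1 => by linear_combination h1 / 2⟩
  rw [ThreeZoneHam.annulusCurve, hR, hL, hlow, hup, loopSet]
  have p2 := (arcTime_short_pos h h).le
  refine Subset.antisymm ?_ ?_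
  · rintro _ (((⟨t, ht, rfl⟩ | hz) | ⟨t, ht, rfl⟩) | hz)
    · rcases mem_Icc_cases ht with rfl | rfl | ht
      · exact Or.inr ⟨_, right_mem_Icc.2 p2, by rw [H.arcUpper_end, arcR_zero]⟩
      · exact Or.inl (Or.inl (Or.inr ⟨_, left_mem_Icc.2 p2, by rw [H.arcR_end, arcLower_zero]⟩))
      · exact Or.inl (Or.inl (Or.inl ⟨t, ht, rfl⟩))
    · exact Or.inl (Or.inl (Or.inr hz))
    · rcases mem_Icc_cases ht with rfl | rfl | ht
      · exact Or.inl (Or.inl (Or.inr ⟨_, right_mem_Icc.2 p2, by rw [H.arcLower_end, arcL_zero]⟩))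
      · exact Or.inr ⟨_, left_mem_Icc.2 p2, by rw [H.arcL_end, arcUpper_zero]⟩
      · exact Or.inl (Or.inr ⟨t, ht, rfl⟩)
    · exact Or.inr hz
  · exact union_subset_union (union_subset_union (union_subset_union
      (image_mono Ioo_subset_Icc_self) subset_rfl)
      (image_mono Ioo_subset_Icc_self)) subset_rfl

/-! ### Continuous dependence of the orbits on the parameters -/

theorem continuous_arcR : Continuous fun x : ℝ × ℝ × ℝ => arcR x.1 x.2.1 x.2.2 := by
  simp only [arcR_eq, focusFlow]; fun_prop

theorem continuous_arcLower : Continuous fun x : ℝ × ℝ × ℝ => arcLower x.1 x.2.1 x.2.2 := by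
  simp only [arcLower_eq, focusFlow]; fun_prop

theorem continuous_arcL : Continuous fun x : ℝ × ℝ × ℝ => arcL x.1 x.2.1 x.2.2 := by
  simp only [arcL_eq, focusFlow]; fun_prop

theorem continuous_arcUpper : Continuous fun x : ℝ × ℝ × ℝ => arcUpper x.1 x.2.1 x.2.2 := by
  simp only [arcUpper_eq, focusFlow]; fun_prop

/-- Each of the two sets lies in the open `δ`-neighbourhood of the other. -/
def HausdorffClose (δ : ℝ) (S S' : Set (ℝ × ℝ)) : Prop :=
  S ⊆ Metric.thickening δ S' ∧ S' ⊆ Metric.thickening δ S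

theorem HausdorffClose.union {δ : ℝ} {S S' R R' : Set (ℝ × ℝ)} (h : HausdorffClose δ S S')
    (h' : HausdorffClose δ R R') : HausdorffClose δ (S ∪ R) (S' ∪ R') := by
  simp only [HausdorffClose, Metric.thickening_union] at *
  exact ⟨union_subset_union h.1 h'.1, union_subset_union h.2 h'.2⟩

theorem continuous_arcTime (θ : ℝ) : Continuous fun x : ℝ × ℝ => arcTime θ x.1 x.2 := by
  have := Real.continuous_arctan
  simp only [arcTime]; fun_prop

theorem eventually_hausdorffClose_arc {arc : ℝ → ℝ → ℝ → ℝ × ℝ}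
    (harc : Continuous fun x : ℝ × ℝ × ℝ => arc x.1 x.2.1 x.2.2) {θ : ℝ}
    (hθ : ∀ p q, 0 ≤ arcTime θ p q) {ι : Type*} {f : Filter ι} {a p q : ι → ℝ} {a₀ p₀ q₀ : ℝ}
    (ha : Tendsto a f (𝓝 a₀)) (hp : Tendsto p f (𝓝 p₀)) (hq : Tendsto q f (𝓝 q₀)) {δ : ℝ}
    (hδ : 0 < δ) : ∀ᶠ i in f, HausdorffClose δ
      (arc (a i) (p i) '' Icc 0 (arcTime θ (p i) (q i))) (arc a₀ p₀ '' Icc 0 (arcTime θ p₀ q₀)) := by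
  have hT := continuous_arcTime θ
  let G : (ℝ × ℝ × ℝ) → ℝ → ℝ × ℝ := fun x s => arc x.1 x.2.1 (s * arcTime θ x.2.1 x.2.2)
  have hG : Continuous fun z : (ℝ × ℝ × ℝ) × ℝ => G z.1 z.2 :=
    harc.comp (g := fun x : ℝ × ℝ × ℝ => arc x.1 x.2.1 x.2.2)
      (f := fun z : (ℝ × ℝ × ℝ) × ℝ => (z.1.1, z.1.2.1, z.2 * arcTime θ z.1.2.1 z.1.2.2))
      (by
        have := hT.comp (show Continuous fun z : (ℝ × ℝ × ℝ) × ℝ => (z.1.2.1, z.1.2.2) by fun_prop)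
        simp only [Function.comp_def] at this
        fun_prop)
  have himg : ∀ a p q, arc a p '' Icc 0 (arcTime θ p q) = G (a, p, q) '' Icc 0 1 := by
    intro a p q
    have : G (a, p, q) = arc a p ∘ fun s => s * arcTime θ p q := rfl
    rw [this, image_comp]
    congr 1
    rcases (hθ p q).eq_or_lt with h | h
    · rw [← h]; simp
    · rw [image_mul_right_Icc zero_le_one (hθ p q), zero_mul, one_mul]
  have hloc : ∀ᶠ x in 𝓝 (a₀, p₀, q₀), ∀ s ∈ Icc (0 : ℝ) 1, dist (G x s) (G (a₀, p₀, q₀) s) < δ := by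
    refine isCompact_Icc.eventually_forall_of_forall_eventually fun s _ => ?_
    have hc : Continuous fun z : (ℝ × ℝ × ℝ) × ℝ => dist (G z.1 z.2) (G (a₀, p₀, q₀) z.2) :=
      hG.dist (hG.comp (f := fun z : (ℝ × ℝ × ℝ) × ℝ => ((a₀, p₀, q₀), z.2)) (by fun_prop))
    refine hc.continuousAt.eventually_lt_const ?_
    simpa using hδ
  filter_upwards [(ha.prodMk_nhds (hp.prodMk_nhds hq)).eventually hloc] with i hi
  rw [himg, himg]
  refine ⟨?_, ?_⟩ <;> rintro _ ⟨s, hs, rfl⟩ <;> rw [Metric.mem_thickening_iff]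
  · exact ⟨_, ⟨s, hs, rfl⟩, hi s hs⟩
  · exact ⟨_, ⟨s, hs, rfl⟩, by rw [dist_comm]; exact hi s hs⟩

theorem eventually_hausdorffClose_loopSet {ι : Type*} {f : Filter ι}
    {a b c h₀ h₁ h₂ h₃ h₄ : ι → ℝ} {h : ℝ}
    (ha : Tendsto a f (𝓝 0)) (hb : Tendsto b f (𝓝 0)) (hc : Tendsto c f (𝓝 0))
    (h0 : Tendsto h₀ f (𝓝 h)) (h1 : Tendsto h₁ f (𝓝 h)) (h2 : Tendsto h₂ f (𝓝 h))
    (h3 : Tendsto h₃ f (𝓝 h)) (h4 : Tendsto h₄ f (𝓝 h)) {δ : ℝ} (hδ : 0 < δ) :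
    ∀ᶠ i in f, HausdorffClose δ (loopSet (a i) (b i) (c i) (h₀ i) (h₁ i) (h₂ i) (h₃ i) (h₄ i))
      (loopSet 0 0 0 h h h h h) := by
  have t1 : ∀ p q, 0 ≤ arcTime (2 * Real.pi) p q := fun p q =>
    (Real.pi_pos.trans (pi_lt_arcTime_long p q)).le
  have t2 : ∀ p q, 0 ≤ arcTime Real.pi p q := fun p q => (arcTime_short_pos p q).le
  filter_upwards [eventually_hausdorffClose_arc continuous_arcR t1 ha h0 h1 hδ,
    eventually_hausdorffClose_arc continuous_arcLower t2 hb h1 h2 hδ,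
    eventually_hausdorffClose_arc continuous_arcL t1 hc (h2.div_const 2) (h3.div_const 2) hδ,
    eventually_hausdorffClose_arc continuous_arcUpper t2 hb h3 h4 hδ] with i i1 i2 i3 i4
  exact ((i1.union i2).union i3).union i4

/-! ### The return map and its first order expansion -/

section Return

/-- The first intersection of the orbit of `(1, h)` with `x = 1` is `(1, -return₁ a h)`. -/
def return₁ (a h : ℝ) : ℝ := focusMap (2 * Real.pi) a h

/-- The first intersection of the orbit of `(1, h)` with `x = -1` is `(-1, -return₂ a b h)`. -/
def return₂ (a b h : ℝ) : ℝ := focusMap Real.pi b (return₁ a h)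

/-- The second intersection of the orbit of `(1, h)` with `x = -1` is `(-1, return₃ a b c h)`; the
half-return map of the left focus is conjugated by the factor `2` of the left chart. -/
def return₃ (a b c h : ℝ) : ℝ := 2 * focusMap (2 * Real.pi) c (return₂ a b h / 2)

/-- The return map of the half-line `x = 1`, `y > 0`. -/
def returnMap (a b c h : ℝ) : ℝ := focusMap Real.pi b (return₃ a b c h)

variable (kR kC kL : ℝ)

theorem tendsto_mul_const_zero (k : ℝ) : Tendsto (fun ε : ℝ => ε * k) (𝓝[>] 0) (𝓝 0) := by
  have : Tendsto (fun ε : ℝ => ε * k) (𝓝 0) (𝓝 0) := by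
    have h : Continuous fun ε : ℝ => ε * k := by fun_prop
    simpa using h.tendsto 0
  exact this.mono_left nhdsWithin_le_nhds

/-- For weak foci the return map is defined and analytic on any half-line `(α, ∞)`, `α > 0`. -/
theorem eventually_orbitChain {α : ℝ} (hα : 0 < α) : ∀ᶠ ε in 𝓝[>] (0 : ℝ), ∀ h, α < h →
    OrbitChain (α / 5) (ε * kR) (ε * kC) (ε * kL) h (return₁ (ε * kR) h)
      (return₂ (ε * kR) (ε * kC) h) (return₃ (ε * kR) (ε * kC) (ε * kL) h)
      (returnMap (ε * kR) (ε * kC) (ε * kL) h) ∧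
    AnalyticAt ℝ (returnMap (ε * kR) (ε * kC) (ε * kL)) h := by
  have tR := tendsto_mul_const_zero kR
  have tC := tendsto_mul_const_zero kC
  have tL := tendsto_mul_const_zero kL
  filter_upwards [tR.eventually (eventually_focusMap (2 * Real.pi) (α := α) (α' := 4 / 5 * α)
      (by linarith) (by linarith)),
    tC.eventually (eventually_focusMap Real.pi (α := 4 / 5 * α) (α' := 3 / 5 * α)
      (by linarith) (by linarith)),
    tL.eventually (eventually_focusMap (2 * Real.pi) (α := 3 / 10 * α) (α' := 2 / 10 * α)
      (by linarith) (by linarith)),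
    tC.eventually (eventually_focusMap Real.pi (α := 2 / 5 * α) (α' := 1 / 5 * α)
      (by linarith) (by linarith)),
    tR.abs.eventually_lt_const (u := α / 5) (by simpa using by linarith),
    tL.abs.eventually_lt_const (u := α / 10) (by simpa using by linarith)]
    with ε e1 e2 e3 e4 e5 e6 h hh
  obtain ⟨a1, s1, n1⟩ := e1.2 h hh
  obtain ⟨a2, s2, n2⟩ := e2.2 _ a1
  obtain ⟨a3, s3, n3⟩ := e3.2 (focusMap Real.pi (ε * kC) (focusMap (2 * Real.pi) (ε * kR) h) / 2)
    (by linarith)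
  obtain ⟨a4, s4, n4⟩ := e4.2 (2 * focusMap (2 * Real.pi) (ε * kL)
    (focusMap Real.pi (ε * kC) (focusMap (2 * Real.pi) (ε * kR) h) / 2)) (by linarith)
  refine ⟨⟨e5.le, by linarith [e4.1], by linarith, by linarith, ?_, ?_, ?_, ?_, s1, s2, ?_, s4⟩, ?_⟩
  · simp only [return₁]; linarith
  · simp only [return₂, return₁]; linarith
  · simp only [return₃, return₂, return₁]; linarith
  · simp only [returnMap, return₃, return₂, return₁]; linarith
  · simp only [return₃, mul_div_cancel_left₀ _ (two_ne_zero' ℝ)]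
    exact s3
  · have n12 := n2.comp n1
    have n123 := AnalyticAt.comp (f := fun h => focusMap Real.pi (ε * kC)
      (focusMap (2 * Real.pi) (ε * kR) h) / 2) n3 n12.div_const
    exact AnalyticAt.comp (f := fun h => 2 * focusMap (2 * Real.pi) (ε * kL)
      (focusMap Real.pi (ε * kC) (focusMap (2 * Real.pi) (ε * kR) h) / 2)) n4
      (analyticAt_const.mul n123)

/-- The first order Melnikov function: the increment of `log (1 + h²) / 2` per turn divided by `ε`,
to leading order. -/
def melnikov (h : ℝ) : ℝ :=
  kR * (2 * Real.pi - Real.arctan h - Real.arctan h) +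
  kC * (Real.pi - Real.arctan h - Real.arctan h) +
  (4 + h ^ 2) / (1 + h ^ 2) *
    (kL * (2 * Real.pi - Real.arctan (h / 2) - Real.arctan (h / 2))) +
  kC * (Real.pi - Real.arctan h - Real.arctan h)

theorem FocusStep.focusLog_zero_sub {θ a p q : ℝ} (h : FocusStep θ a p q) :
    focusLog 0 q - focusLog 0 p = a * (θ - Real.arctan p - Real.arctan q) := by
  simp only [FocusStep, focusLog] at *
  linarith

theorem tendsto_focusStep_slope {θ k h : ℝ} {p q : ℝ → ℝ}
    (hp : Tendsto p (𝓝[>] 0) (𝓝 h)) (hq : Tendsto q (𝓝[>] 0) (𝓝 h))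
    (hs : ∀ᶠ ε in 𝓝[>] (0 : ℝ), FocusStep θ (ε * k) (p ε) (q ε)) :
    Tendsto (fun ε => (focusLog 0 (q ε) - focusLog 0 (p ε)) / ε) (𝓝[>] 0)
      (𝓝 (k * (θ - Real.arctan h - Real.arctan h))) := by
  have hc : Continuous Real.arctan := Real.continuous_arctan
  have h1 := ((((hc.tendsto h).comp hp).const_sub θ).sub ((hc.tendsto h).comp hq)).const_mul k
  refine h1.congr' ?_
  filter_upwards [hs, self_mem_nhdsWithin] with ε hε h0
  have : ε ≠ 0 := ne_of_gt h0
  rw [hε.focusLog_zero_sub]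
  simp only [Function.comp_apply]
  field_simp

theorem focusLog_zero_eq (x : ℝ) :
    focusLog 0 x = Real.log (4 * Real.exp (2 * focusLog 0 (x / 2)) - 3) / 2 := by
  simp only [focusLog, zero_mul, add_zero]
  rw [mul_div_cancel₀ _ (two_ne_zero' ℝ), Real.exp_log (one_add_sq_pos _)]
  congr 2; ring

theorem hasStrictDerivAt_log_exp (h : ℝ) : HasStrictDerivAt
    (fun s => Real.log (4 * Real.exp (2 * s) - 3) / 2) ((4 + h ^ 2) / (1 + h ^ 2))
    (focusLog 0 (h / 2)) := by
  have he : Real.exp (2 * focusLog 0 (h / 2)) = 1 + (h / 2) ^ 2 := by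
    simp only [focusLog, zero_mul, add_zero]
    rw [mul_div_cancel₀ _ (two_ne_zero' ℝ), Real.exp_log (one_add_sq_pos _)]
  have hpos : 4 * Real.exp (2 * focusLog 0 (h / 2)) - 3 = 1 + h ^ 2 := by rw [he]; ring
  have h1 : HasStrictDerivAt (fun s : ℝ => 4 * Real.exp (2 * s) - 3)
      (4 * (Real.exp (2 * focusLog 0 (h / 2)) * (2 * 1))) (focusLog 0 (h / 2)) :=
    ((((hasStrictDerivAt_id _).const_mul 2).exp).const_mul 4).sub_const 3
  have h2 := (h1.log (by rw [hpos]; exact (one_add_sq_pos h).ne')).div_const 2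
  refine h2.congr_deriv ?_
  rw [hpos, he]
  have := (one_add_sq_pos h).ne'
  field_simp
  ring

/-- A first order difference is multiplied by the derivative of a strictly differentiable function
that is applied to it. -/
theorem HasStrictDerivAt.tendsto_sub_div {F : ℝ → ℝ} {F' x c : ℝ} (hF : HasStrictDerivAt F F' x)
    {f : Filter ℝ} {u v : ℝ → ℝ} (hu : Tendsto u f (𝓝 x)) (hv : Tendsto v f (𝓝 x))
    (h : Tendsto (fun ε => (u ε - v ε) / ε) f (𝓝 c)) :
    Tendsto (fun ε => (F (u ε) - F (v ε)) / ε) f (𝓝 (F' * c)) := by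
  have h1 := hF.hasStrictFDerivAt.isLittleO.comp_tendsto (hu.prodMk_nhds hv)
  simp only [Function.comp_def, ContinuousLinearMap.toSpanSingleton_apply] at h1
  have h2 : (fun ε => (u ε - v ε) / ε) =O[f] fun _ => (1 : ℝ) := h.isBigO_one ℝ
  have h3 : (fun ε => (F (u ε) - F (v ε) - (u ε - v ε) • F') / ε) =o[f]
      fun ε => (u ε - v ε) / ε := by
    simpa only [div_eq_mul_inv] using h1.mul_isBigO (Asymptotics.isBigO_refl (fun ε => ε⁻¹) f)
  have h4 := (Asymptotics.isLittleO_one_iff ℝ).1 (h3.trans_isBigO h2)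
  have h5 := h4.add (h.const_mul F')
  rw [zero_add] at h5
  refine h5.congr fun ε => ?_
  rw [smul_eq_mul]
  ring

theorem tendsto_return {h : ℝ} (hh : 0 < h) {y : ℝ → ℝ} (hy : Tendsto y (𝓝[>] 0) (𝓝 h)) :
    Tendsto (fun ε => return₁ (ε * kR) (y ε)) (𝓝[>] 0) (𝓝 h) ∧
    Tendsto (fun ε => return₂ (ε * kR) (ε * kC) (y ε)) (𝓝[>] 0) (𝓝 h) ∧
    Tendsto (fun ε => return₃ (ε * kR) (ε * kC) (ε * kL) (y ε)) (𝓝[>] 0) (𝓝 h) ∧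
    Tendsto (fun ε => returnMap (ε * kR) (ε * kC) (ε * kL) (y ε)) (𝓝[>] 0) (𝓝 h) := by
  have hch : ∀ᶠ ε in 𝓝[>] (0 : ℝ), OrbitChain (h / 2 / 5) (ε * kR) (ε * kC) (ε * kL) (y ε)
      (return₁ (ε * kR) (y ε)) (return₂ (ε * kR) (ε * kC) (y ε))
      (return₃ (ε * kR) (ε * kC) (ε * kL) (y ε)) (returnMap (ε * kR) (ε * kC) (ε * kL) (y ε)) := by
    filter_upwards [eventually_orbitChain kR kC kL (half_pos hh),
      hy.eventually_const_lt (half_lt_self hh)] with ε e1 e2 using (e1 _ e2).1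
  have h1 := tendsto_of_focusStep hh (tendsto_mul_const_zero kR) hy
    (hch.mono fun ε H => H.eta_nonneg.trans_lt H.lt₁) (hch.mono fun ε H => H.right)
  have h2 := tendsto_of_focusStep hh (tendsto_mul_const_zero kC) h1
    (hch.mono fun ε H => H.eta_nonneg.trans_lt H.lt₂) (hch.mono fun ε H => H.lower)
  have h3 := tendsto_of_focusStep (half_pos hh) (tendsto_mul_const_zero kL) (h2.div_const 2)
    (hch.mono fun ε H => half_pos (H.eta_nonneg.trans_lt H.lt₃)) (hch.mono fun ε H => H.left)
  have h3' := h3.mul_const 2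
  simp only [div_mul_cancel₀ _ (two_ne_zero' ℝ)] at h3'
  have h4 := tendsto_of_focusStep hh (tendsto_mul_const_zero kC) h3'
    (hch.mono fun ε H => H.eta_nonneg.trans_lt H.lt₄) (hch.mono fun ε H => H.upper)
  exact ⟨h1, h2, h3', h4⟩

/-- The displacement of the return map, measured in the coordinate `log (1 + h²) / 2`. -/
def displacement (ε h : ℝ) : ℝ :=
  focusLog 0 (returnMap (ε * kR) (ε * kC) (ε * kL) h) - focusLog 0 h

theorem tendsto_displacement_div {h : ℝ} (hh : 0 < h) :
    Tendsto (fun ε => displacement kR kC kL ε h / ε) (𝓝[>] 0) (𝓝 (melnikov kR kC kL h)) := by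
  have hch := (eventually_orbitChain kR kC kL (half_pos hh)).mono
    fun ε e => (e h (half_lt_self hh)).1
  have h0 : Tendsto (fun _ : ℝ => h) (𝓝[>] 0) (𝓝 h) := tendsto_const_nhds
  obtain ⟨h1, h2, h3, h4⟩ := tendsto_return kR kC kL hh h0
  have s1 := tendsto_focusStep_slope h0 h1 (hch.mono fun ε H => H.right)
  have s2 := tendsto_focusStep_slope h1 h2 (hch.mono fun ε H => H.lower)
  have s3 := tendsto_focusStep_slope (h2.div_const 2) (h3.div_const 2)
    (hch.mono fun ε H => H.left)
  have s4 := tendsto_focusStep_slope h3 h4 (hch.mono fun ε H => H.upper)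
  have hF := (continuous_focusLog 0).tendsto (h / 2)
  have s3' := (hasStrictDerivAt_log_exp h).tendsto_sub_div (hF.comp (h3.div_const 2))
    (hF.comp (h2.div_const 2)) s3
  simp only [Function.comp_apply, ← focusLog_zero_eq] at s3'
  refine (((s1.add s2).add s3').add s4).congr fun ε => ?_
  simp only [displacement]
  ring

theorem analyticAt_melnikov (h : ℝ) : AnalyticAt ℝ (melnikov kR kC kL) h := by
  have hat : ∀ y, AnalyticAt ℝ Real.arctan y := fun y => Real.contDiff_arctan.contDiffAt.analyticAt
  have h1 := hat h
  have h2 : AnalyticAt ℝ (fun h : ℝ => Real.arctan (h / 2)) h :=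
    AnalyticAt.comp (f := fun h : ℝ => h / 2) (hat (h / 2)) (by fun_prop)
  have h3 : AnalyticAt ℝ (fun h : ℝ => (4 + h ^ 2) / (1 + h ^ 2)) h :=
    AnalyticAt.div (by fun_prop) (by fun_prop) (one_add_sq_pos h).ne'
  unfold melnikov
  fun_prop

end Return

/-! ### Zeros of the displacement function -/

/-- An analytic function that changes sign on an interval has a zero at which it takes both signs
arbitrarily closely. -/
theorem exists_sign_change {m : ℝ → ℝ} (hm : ∀ x, AnalyticAt ℝ m x) {l r : ℝ} (hlr : l < r)
    (hl : m l < 0) (hr : 0 < m r) : ∃ z ∈ Ioo l r, ∀ δ > 0,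
      (∃ x ∈ Ioo (z - δ) z, m x < 0) ∧ ∃ x ∈ Ioo z (z + δ), 0 < m x := by
  have hc : Continuous m := continuous_iff_continuousAt.2 fun x => (hm x).continuousAt
  let S : Set ℝ := {x | x ∈ Icc l r ∧ m x < 0}
  have hlS : l ∈ S := ⟨left_mem_Icc.2 hlr.le, hl⟩
  have hbdd : BddAbove S := ⟨r, fun x hx => hx.1.2⟩
  have hge : l ≤ sSup S := le_csSup hbdd hlS
  have hle : sSup S ≤ r := csSup_le ⟨l, hlS⟩ fun x hx => hx.1.2
  have hright : ∀ x, sSup S < x → x ≤ r → 0 ≤ m x := by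
    intro x h1 h2
    by_contra! h
    exact h1.not_ge (le_csSup hbdd ⟨⟨hge.trans h1.le, h2⟩, h⟩)
  have hz0 : m (sSup S) ≤ 0 := by
    have : closure S ⊆ {x | m x ≤ 0} := closure_minimal (fun x hx => hx.2.le)
      (isClosed_le hc continuous_const)
    exact this (csSup_mem_closure ⟨l, hlS⟩ hbdd)
  have hltr : sSup S < r := lt_of_le_of_ne hle fun h => by rw [h] at hz0; exact hz0.not_gt hr
  have hz : m (sSup S) = 0 := by
    refine le_antisymm hz0 ?_
    have hev : ∀ᶠ x in 𝓝[>] (sSup S), 0 ≤ m x := by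
      filter_upwards [Ioo_mem_nhdsGT hltr] with x hx using hright x hx.1 hx.2.le
    exact ge_of_tendsto (hc.continuousAt.tendsto.mono_left nhdsWithin_le_nhds) hev
  have hgtl : l < sSup S := lt_of_le_of_ne hge fun h => by rw [← h] at hz; exact hl.ne hz
  refine ⟨sSup S, ⟨hgtl, hltr⟩, fun δ hδ => ⟨?_, ?_⟩⟩
  · obtain ⟨x, hxS, hx⟩ := exists_lt_of_lt_csSup ⟨l, hlS⟩ (sub_lt_self (sSup S) hδ)
    refine ⟨x, ⟨hx, lt_of_le_of_ne (le_csSup hbdd hxS) fun h => ?_⟩, hxS.2⟩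
    exact hxS.2.ne (h ▸ hz)
  · by_contra! hcon
    have hev : ∃ᶠ x in 𝓝[≠] (sSup S), m x = 0 := by
      have h1 : ∀ᶠ x in 𝓝[>] (sSup S), m x = 0 := by
        filter_upwards [Ioo_mem_nhdsGT hltr, Ioo_mem_nhdsGT (lt_add_of_pos_right (sSup S) hδ)]
          with x hx hx'
        exact le_antisymm (hcon x hx') (hright x hx.1 hx.2.le)
      exact h1.frequently.filter_mono (nhdsWithin_mono _ fun x hx => ne_of_gt hx)
    have := AnalyticOnNhd.eqOn_zero_of_preconnected_of_frequently_eq_zero (U := univ)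
      (fun x _ => hm x) isPreconnected_univ (mem_univ _) hev (mem_univ r)
    exact hr.ne' this

/-- Zeros of a sign-changing leading coefficient persist as isolated zeros of an analytic
function. -/
theorem exists_isolated_zero {d : ℝ → ℝ → ℝ} {m : ℝ → ℝ} {L z R : ℝ} (hz : z ∈ Ioo L R)
    (han : ∀ᶠ ε in 𝓝[>] (0 : ℝ), ∀ x ∈ Icc L R, AnalyticAt ℝ (d ε) x)
    (hlim : ∀ x ∈ Icc L R, Tendsto (fun ε => d ε x / ε) (𝓝[>] 0) (𝓝 (m x)))
    (hsign : ∀ δ > 0, ∃ x ∈ Ioo (z - δ) z, ∃ y ∈ Ioo z (z + δ), m x * m y < 0) :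
    ∃ y : ℝ → ℝ, Tendsto y (𝓝[>] 0) (𝓝 z) ∧ ∀ᶠ ε in 𝓝[>] (0 : ℝ), y ε ∈ Ioo L R ∧
      d ε (y ε) = 0 ∧ ∀ᶠ x in 𝓝[≠] (y ε), d ε x ≠ 0 := by
  have key : ∀ δ > 0, ∀ᶠ ε in 𝓝[>] (0 : ℝ), (∃ x ∈ Icc L R, d ε x ≠ 0) ∧
      ∃ x ∈ Ioo L R, |x - z| < δ ∧ d ε x = 0 := by
    intro δ hδ
    obtain ⟨x, hx, y, hy, hxy⟩ := hsign (min δ (min (z - L) (R - z)))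
      (lt_min hδ (lt_min (by linarith [hz.1]) (by linarith [hz.2])))
    have m1 : min δ (min (z - L) (R - z)) ≤ δ := min_le_left _ _
    have m2 : min δ (min (z - L) (R - z)) ≤ z - L := (min_le_right _ _).trans (min_le_left _ _)
    have m3 : min δ (min (z - L) (R - z)) ≤ R - z := (min_le_right _ _).trans (min_le_right _ _)
    have hxI : x ∈ Icc L R := ⟨by linarith [hx.1], by linarith [hx.2, hz.2]⟩
    have hyI : y ∈ Icc L R := ⟨by linarith [hy.1, hz.1], by linarith [hy.2]⟩
    filter_upwards [han, ((hlim x hxI).mul (hlim y hyI)).eventually_lt_const hxy,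
      self_mem_nhdsWithin] with ε e1 e2 (e3 : 0 < ε)
    rw [div_mul_div_comm, div_neg_iff] at e2
    have e4 : d ε x * d ε y < 0 := by
      rcases e2 with h | h
      · exact absurd h.2 (mul_pos e3 e3).not_gt
      · exact h.1
    refine ⟨⟨x, hxI, fun h => by simp [h] at e4⟩, ?_⟩
    have hxy' : x ≤ y := (hx.2.trans hy.1).le
    have hcont : ContinuousOn (d ε) (uIcc x y) := by
      rw [uIcc_of_le hxy']
      exact fun t ht => (e1 t ⟨hxI.1.trans ht.1, ht.2.trans hyI.2⟩).continuousAt.continuousWithinAt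
    have h0 : (0 : ℝ) ∈ uIcc (d ε x) (d ε y) := by
      rw [mem_uIcc]
      rcases mul_neg_iff.1 e4 with h | h
      · exact Or.inr ⟨h.2.le, h.1.le⟩
      · exact Or.inl ⟨h.1.le, h.2.le⟩
    obtain ⟨t, ht, e⟩ := intermediate_value_uIcc hcont h0
    rw [uIcc_of_le hxy'] at ht
    refine ⟨t, ⟨?_, ?_⟩, ?_, e⟩
    · linarith [hx.1, ht.1]
    · linarith [hy.2, ht.2]
    · rw [abs_lt]; exact ⟨by linarith [hx.1, ht.1], by linarith [hy.2, ht.2]⟩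
  -- among the zeros of `d ε` take one that is closest to `z`
  classical
  let Z : ℝ → Set ℝ := fun ε => {x | x ∈ Icc L R ∧ d ε x = 0}
  let Q : ℝ → ℝ → Prop := fun ε x => x ∈ Z ε ∧ ∀ x' ∈ Z ε, |x - z| ≤ |x' - z|
  have hQ : ∀ᶠ ε in 𝓝[>] (0 : ℝ), ∃ x, Q ε x := by
    filter_upwards [han, key 1 one_pos] with ε e1 ⟨_, x, hx, _, hx0⟩
    have hcont : ContinuousOn (d ε) (Icc L R) := fun t ht =>
      (e1 t ht).continuousAt.continuousWithinAt
    have hcomp : IsCompact (Z ε) := by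
      have := hcont.preimage_isClosed_of_isClosed isClosed_Icc (isClosed_singleton (x := (0 : ℝ)))
      exact isCompact_Icc.of_isClosed_subset this inter_subset_left
    obtain ⟨y, hy, hmin⟩ := hcomp.exists_isMinOn ⟨x, Ioo_subset_Icc_self hx, hx0⟩
      (f := fun x => |x - z|) (by fun_prop)
    exact ⟨y, hy, fun x' hx' => hmin hx'⟩
  let y : ℝ → ℝ := fun ε => if h : ∃ x, Q ε x then h.choose else z
  have hy : ∀ᶠ ε in 𝓝[>] (0 : ℝ), Q ε (y ε) := by
    filter_upwards [hQ] with ε h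
    simp only [y, dif_pos h]
    exact h.choose_spec
  have hclose : ∀ δ > 0, ∀ᶠ ε in 𝓝[>] (0 : ℝ), |y ε - z| < δ := by
    intro δ hδ
    filter_upwards [hy, key δ hδ] with ε e1 ⟨_, x, hx, hxδ, hx0⟩
    exact (e1.2 x ⟨Ioo_subset_Icc_self hx, hx0⟩).trans_lt hxδ
  have htend : Tendsto y (𝓝[>] 0) (𝓝 z) := Metric.tendsto_nhds.2 fun δ hδ => by
    simpa only [Real.dist_eq] using hclose δ hδ
  refine ⟨y, htend, ?_⟩
  filter_upwards [htend.eventually (Ioo_mem_nhds hz.1 hz.2), hy, han, key 1 one_pos]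
    with ε e1 e2 e3 ⟨⟨x, hx, hne⟩, _⟩
  refine ⟨e1, e2.1.2, ?_⟩
  rcases (e3 _ (Ioo_subset_Icc_self e1)).eventually_eq_zero_or_eventually_ne_zero with h | h
  · exact absurd (AnalyticOnNhd.eqOn_zero_of_preconnected_of_eventuallyEq_zero e3
      isPreconnected_Icc (Ioo_subset_Icc_self e1) h hx) hne
  · exact h

/-! ### Bifurcation of limit cycles -/

/-- The loop of the orbit of `(1, h)` for the foci with strengths `ε kR`, `ε kC`, `ε kL`. -/
def returnLoop (kR kC kL ε h : ℝ) : Set (ℝ × ℝ) :=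
  loopSet (ε * kR) (ε * kC) (ε * kL) h (return₁ (ε * kR) h) (return₂ (ε * kR) (ε * kC) h)
    (return₃ (ε * kR) (ε * kC) (ε * kL) h) h

/-- Each sign change of the Melnikov function gives rise to a limit cycle. -/
theorem exists_limitCycle_branch (kR kC kL : ℝ) {l r : ℝ} (hl0 : 0 < l) (hlr : l < r)
    (hs : melnikov kR kC kL l * melnikov kR kC kL r < 0) :
    ∃ z ∈ Ioo l r, ∃ y : ℝ → ℝ, Tendsto y (𝓝[>] 0) (𝓝 z) ∧
      ∀ᶠ ε in 𝓝[>] (0 : ℝ), y ε ∈ Ioo l r ∧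
        (spiralField (ε * kR) (ε * kC) (ε * kL)).IsLimitCycle (returnLoop kR kC kL ε (y ε)) ∧
        (spiralField (ε * kR) (ε * kC) (ε * kL)).IsCrossing (returnLoop kR kC kL ε (y ε)) ∧
        VisitsThreeZones (returnLoop kR kC kL ε (y ε)) ∧
        ∀ h > 0, (1, h) ∈ returnLoop kR kC kL ε (y ε) → h = y ε := by
  have hsc : ∃ z ∈ Ioo l r, ∀ δ > 0, ∃ x ∈ Ioo (z - δ) z, ∃ y ∈ Ioo z (z + δ),
      melnikov kR kC kL x * melnikov kR kC kL y < 0 := by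
    rcases mul_neg_iff.1 hs with h | h
    · obtain ⟨z, hz, hsg⟩ := exists_sign_change (m := fun x => -melnikov kR kC kL x)
        (fun x => (analyticAt_melnikov kR kC kL x).neg) hlr (by linarith) (by linarith)
      refine ⟨z, hz, fun δ hδ => ?_⟩
      obtain ⟨⟨x, hx, hx0⟩, y, hy, hy0⟩ := hsg δ hδ
      exact ⟨x, hx, y, hy, mul_neg_of_pos_of_neg (by linarith) (by linarith)⟩
    · obtain ⟨z, hz, hsg⟩ := exists_sign_change (fun x => analyticAt_melnikov kR kC kL x) hlr h.1 h.2
      refine ⟨z, hz, fun δ hδ => ?_⟩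
      obtain ⟨⟨x, hx, hx0⟩, y, hy, hy0⟩ := hsg δ hδ
      exact ⟨x, hx, y, hy, mul_neg_of_neg_of_pos hx0 hy0⟩
  obtain ⟨z, hz, hsg⟩ := hsc
  have hch := eventually_orbitChain kR kC kL (half_pos hl0)
  have hhalf : ∀ x ∈ Icc l r, l / 2 < x := fun x hx => (half_lt_self hl0).trans_le hx.1
  have han : ∀ᶠ ε in 𝓝[>] (0 : ℝ), ∀ x ∈ Icc l r, AnalyticAt ℝ (displacement kR kC kL ε) x := by
    filter_upwards [hch] with ε e x hx
    exact ((analyticAt_focusLog 0 _).comp (e x (hhalf x hx)).2).sub (analyticAt_focusLog 0 x)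
  obtain ⟨y, hy, hev⟩ := exists_isolated_zero hz han (fun x hx =>
    tendsto_displacement_div kR kC kL (hl0.trans_le hx.1)) hsg
  refine ⟨z, hz, y, hy, ?_⟩
  filter_upwards [hch, hev] with ε e1 ⟨hyI, hy0, hyiso⟩
  have hzero : ∀ x, l / 2 < x → (displacement kR kC kL ε x = 0 ↔
      returnMap (ε * kR) (ε * kC) (ε * kL) x = x) := by
    intro x hx
    have H := (e1 x hx).1
    have hp0 := H.eta_nonneg
    rw [displacement, sub_eq_zero]
    refine ⟨fun h => ?_, fun h => by rw [h]⟩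
    exact (strictMonoOn_focusLog 0).injOn (by simpa using hp0.trans H.lt₄.le)
      (by simpa using hp0.trans H.lt₀.le) h
  have hyhalf := hhalf _ (Ioo_subset_Icc_self hyI)
  have hfix := (hzero _ hyhalf).1 hy0
  have H := (e1 _ hyhalf).1
  rw [hfix] at H
  refine ⟨hyI, ?_, H.isCrossing, H.visitsThreeZones, ?_⟩
  · have hnhds : ∀ᶠ x in 𝓝 (y ε), l / 2 < x ∧ (x ≠ y ε → displacement kR kC kL ε x ≠ 0) :=
      inter_mem (Ioi_mem_nhds hyhalf) (eventually_nhdsWithin_iff.1 hyiso)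
    obtain ⟨l', r', hmem, hsub⟩ := mem_nhds_iff_exists_Ioo_subset.1 hnhds
    refine isLimitCycle_of_isolated (fun x hx => (e1 x (hsub hx).1).1) hmem hfix fun x hx hx' => ?_
    by_contra hne
    exact (hsub hx).2 hne ((hzero x (hsub hx).1).2 hx')
  · intro h hh hmem
    have hη := H.eta_nonneg
    rcases H.loopSet_cases hmem with g | g | g | g | g | g | g | g
    · exact absurd g.1 (lt_irrefl _)
    · exact absurd g.2.1 (lt_irrefl _)
    · exact absurd g.1 (by norm_num)
    · exact congrArg Prod.snd g
    · have := congrArg Prod.snd g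
      dsimp only at this
      linarith [H.lt₁]
    · have := congrArg Prod.fst g
      norm_num at this
    · have := congrArg Prod.fst g
      norm_num at this
    · exact congrArg Prod.snd g

theorem left_mem_returnLoop (kR kC kL ε h : ℝ) : (1, h) ∈ returnLoop kR kC kL ε h :=
  Or.inl (Or.inl (Or.inl ⟨0, left_mem_Icc.2 (Real.pi_pos.trans (pi_lt_arcTime_long _ _)).le,
    arcR_zero _ _⟩))

/-! ### Four sign changes of the Melnikov function -/

theorem arctan_le_self {x : ℝ} (hx : 0 ≤ x) : Real.arctan x ≤ x := by
  have h := Real.le_tan (Real.arctan_nonneg.2 hx) (Real.arctan_lt_pi_div_two x)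
  rwa [Real.tan_arctan] at h

theorem le_arctan_half : Real.pi / 4 - 1 / 3 ≤ Real.arctan (1 / 2) := by
  have h := Real.arctan_inv_2_add_arctan_inv_3
  have h3 := arctan_le_self (x := (3 : ℝ)⁻¹) (by norm_num)
  rw [← one_div] at h
  linarith

theorem melnikov_zero_neg : melnikov (-1 / 5) (-39 / 10) 1 0 < 0 := by
  have := Real.pi_pos
  simp only [melnikov, zero_div, Real.arctan_zero]
  linarith

theorem melnikov_half_pos : 0 < melnikov (-1 / 5) (-39 / 10) 1 (1 / 2) := by
  have h1 := le_arctan_half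
  have h2 := arctan_le_self (x := (1 / 2 / 2 : ℝ)) (by norm_num)
  have h3 := Real.pi_gt_d2
  have e : (4 + (1 / 2 : ℝ) ^ 2) / (1 + (1 / 2) ^ 2) = 17 / 5 := by norm_num
  rw [melnikov, e]
  linarith

theorem melnikov_two_neg : melnikov (-1 / 5) (-39 / 10) 1 2 < 0 := by
  have h1 := le_arctan_half
  have h2 : Real.arctan (1 / 2) = Real.pi / 2 - Real.arctan 2 := by
    rw [one_div]; exact Real.arctan_inv_of_pos two_pos
  have h3 := Real.pi_gt_d2
  have e : (4 + (2 : ℝ) ^ 2) / (1 + 2 ^ 2) = 8 / 5 := by norm_num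
  rw [melnikov, e, div_self two_ne_zero, Real.arctan_one]
  linarith

theorem exists_melnikov_pos : ∃ r : ℝ, 2 < r ∧ 0 < melnikov (-1 / 5) (-39 / 10) 1 r := by
  have hat : Tendsto Real.arctan atTop (𝓝 (Real.pi / 2)) :=
    Real.tendsto_arctan_atTop.mono_right nhdsWithin_le_nhds
  have hat2 : Tendsto (fun h : ℝ => Real.arctan (h / 2)) atTop (𝓝 (Real.pi / 2)) :=
    hat.comp (tendsto_id.atTop_div_const two_pos)
  have hq : Tendsto (fun h : ℝ => (4 + h ^ 2) / (1 + h ^ 2)) atTop (𝓝 1) := by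
    have h1 : Tendsto (fun h : ℝ => 1 + 3 / (1 + h ^ 2)) atTop (𝓝 (1 + 0)) :=
      (tendsto_const_nhds.div_atTop
        (tendsto_atTop_add_const_left _ _ (tendsto_pow_atTop two_ne_zero))).const_add 1
    rw [add_zero] at h1
    refine h1.congr fun h => ?_
    have := (one_add_sq_pos h).ne'
    field_simp
    ring
  have hlim : Tendsto (melnikov (-1 / 5) (-39 / 10) 1) atTop (𝓝 (-1 / 5 *
      (2 * Real.pi - Real.pi / 2 - Real.pi / 2) + -39 / 10 *
      (Real.pi - Real.pi / 2 - Real.pi / 2) + 1 * (1 * (2 * Real.pi - Real.pi / 2 - Real.pi / 2)) +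
      -39 / 10 * (Real.pi - Real.pi / 2 - Real.pi / 2))) :=
    (((((hat.const_sub _).sub hat).const_mul _).add (((hat.const_sub _).sub hat).const_mul _)).add
      (hq.mul (((hat2.const_sub _).sub hat2).const_mul _))).add
      (((hat.const_sub _).sub hat).const_mul _)
  obtain ⟨r, h1, h2⟩ := ((hlim.eventually_const_lt (u := 0) (by
    have := Real.pi_pos
    linarith)).and (eventually_gt_atTop 2)).exists
  exact ⟨r, h2, h1⟩

/-! ### The limit cycles of the piecewise linear system -/

/-- The perturbation: in each zone a multiple of the position vector relative to the center, with
factors `-1/5`, `-39/10` and `1` in the right, central and left zone. -/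
def focusPert : ThreeZonePert where
  L := { p := 1, q := 0, r := 5, s := 0, u := 1, v := -2 }
  C := { p := -39 / 10, q := 0, r := 0, s := 0, u := -39 / 10, v := 0 }
  R := { p := -1 / 5, q := 0, r := 2 / 5, s := 0, u := -1 / 5, v := 0 }

theorem perturbed_eq_spiralField (ε : ℝ) :
    (ThreeZoneHam.normalForm 1 2 (-1) (-3) 0 1 (-1) 2).perturbed focusPert ε =
      spiralField (ε * (-1 / 5)) (ε * (-39 / 10)) (ε * 1) := by
  simp only [ThreeZoneHam.perturbed, spiralField, ThreeZoneHam.normalForm, QuadHam.field,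
    AffinePert.field, focusPert, ThreeZoneField.mk.injEq]
  refine ⟨?_, ?_, ?_⟩ <;> funext z <;> ext <;>
    simp only [Prod.fst_add, Prod.snd_add, Prod.smul_fst, Prod.smul_snd, smul_eq_mul] <;> ring

theorem unperturbed_eq_spiralField :
    (ThreeZoneHam.normalForm 1 2 (-1) (-3) 0 1 (-1) 2).unperturbed = spiralField 0 0 0 := by
  simp only [ThreeZoneHam.unperturbed, spiralField, ThreeZoneHam.normalForm,
    ThreeZoneField.mk.injEq]
  refine ⟨?_, ?_, ?_⟩ <;> funext z <;> ext <;> simp only [QuadHam.field] <;> ring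

theorem hasCenters :
    (ThreeZoneHam.normalForm 1 2 (-1) (-3) 0 1 (-1) 2).L.HasCenterIn zoneL ∧
    (ThreeZoneHam.normalForm 1 2 (-1) (-3) 0 1 (-1) 2).C.HasCenterIn zoneC ∧
    (ThreeZoneHam.normalForm 1 2 (-1) (-3) 0 1 (-1) 2).R.HasCenterIn zoneR := by
  refine ⟨⟨⟨(-5, 2), ?_, ?_⟩, ?_, ?_⟩, ⟨⟨(0, 0), ?_, ?_⟩, ?_, ?_⟩, ⟨⟨(2, 0), ?_, ?_⟩, ?_, ?_⟩⟩
  all_goals norm_num [zoneL, zoneC, zoneR, ThreeZoneHam.normalForm, QuadHam.field,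
    QuadHam.linearPart, Matrix.trace_fin_two, Matrix.det_fin_two]

theorem mainTheorem12 (H : ThreeZoneHam)
    (hH : H = ThreeZoneHam.normalForm (aL := 1) (bL := 2) (cL := -1) (βL := -3)
      (aR := 0) (bR := 1) (cR := -1) (βR := 2)) :
    -- the three subsystems of the unperturbed system have real centers
    (H.L.HasCenterIn zoneL ∧ H.C.HasCenterIn zoneC ∧ H.R.HasCenterIn zoneR) ∧
    -- the curves `L_h`, `h > 0`, form the periodic annulus of the unperturbed system
    (∀ h : ℝ, 0 < h → H.unperturbed.IsPeriodicOrbit (H.annulusCurve h) ∧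
      H.unperturbed.IsCrossing (H.annulusCurve h) ∧ VisitsThreeZones (H.annulusCurve h)) ∧
    -- for a suitable perturbation three limit cycles bifurcate from three of these curves
    ∃ (P : ThreeZonePert) (h : Fin 3 → ℝ), (∀ i, 0 < h i) ∧ Function.Injective h ∧
      ∃ (ε₀ : ℝ) (Γ : ℝ → Fin 3 → Set (ℝ × ℝ)), 0 < ε₀ ∧
        (∀ ε : ℝ, 0 < ε → ε < ε₀ → Function.Injective (Γ ε) ∧
          ∀ i, (H.perturbed P ε).IsLimitCycle (Γ ε i) ∧
            (H.perturbed P ε).IsCrossing (Γ ε i) ∧ VisitsThreeZones (Γ ε i)) ∧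
        ∀ i, ∀ δ : ℝ, 0 < δ → ∀ᶠ ε in 𝓝[>] (0 : ℝ),
          Γ ε i ⊆ Metric.thickening δ (H.annulusCurve (h i)) ∧
          H.annulusCurve (h i) ⊆ Metric.thickening δ (Γ ε i) := by
  subst hH
  refine ⟨hasCenters, fun h hh => ?_, ?_⟩
  · rw [unperturbed_eq_spiralField, ← loopSet_zero_eq_annulusCurve hh]
    have H := orbitChain_zero hh
    exact ⟨H.isPeriodicOrbit, H.isCrossing, H.visitsThreeZones⟩
  obtain ⟨l, hl, hlneg⟩ : ∃ l ∈ Ioo (0 : ℝ) (1 / 2), melnikov (-1 / 5) (-39 / 10) 1 l < 0 := by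
    have h1 := (analyticAt_melnikov (-1 / 5) (-39 / 10) 1 0).continuousAt.eventually_lt_const
      melnikov_zero_neg
    have h2 := (h1.filter_mono nhdsWithin_le_nhds).and
      (Ioo_mem_nhdsGT (show (0 : ℝ) < 1 / 2 by norm_num))
    obtain ⟨l, hl, hl'⟩ := h2.exists
    exact ⟨l, hl', hl⟩
  obtain ⟨r, hr, hrpos⟩ := exists_melnikov_pos
  let lo : Fin 3 → ℝ := ![l, 1 / 2, 2]
  let hi : Fin 3 → ℝ := ![1 / 2, 2, r]
  have hbr : ∀ i, 0 < lo i ∧ lo i < hi i ∧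
      melnikov (-1 / 5) (-39 / 10) 1 (lo i) * melnikov (-1 / 5) (-39 / 10) 1 (hi i) < 0 := by
    intro i
    fin_cases i
    · exact ⟨hl.1, hl.2, mul_neg_of_neg_of_pos hlneg melnikov_half_pos⟩
    · exact ⟨by norm_num [lo], by norm_num [lo, hi],
        mul_neg_of_pos_of_neg melnikov_half_pos melnikov_two_neg⟩
    · exact ⟨by norm_num [lo], hr, mul_neg_of_neg_of_pos melnikov_two_neg hrpos⟩
  have hdisj : ∀ x : Fin 3 → ℝ, (∀ i, x i ∈ Ioo (lo i) (hi i)) → Function.Injective x := by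
    intro x hx
    have h0 : x 0 < 1 / 2 := (hx 0).2
    have h1 : 1 / 2 < x 1 := (hx 1).1
    have h1' : x 1 < 2 := (hx 1).2
    have h2 : 2 < x 2 := (hx 2).1
    refine StrictMono.injective (Fin.strictMono_iff_lt_succ.2 fun i => ?_)
    fin_cases i
    · exact h0.trans h1
    · exact h1'.trans h2
  choose h hmem y hy hev using fun i =>
    exists_limitCycle_branch (-1 / 5) (-39 / 10) 1 (hbr i).1 (hbr i).2.1 (hbr i).2.2
  have hall := eventually_all.2 hev
  obtain ⟨ε₀, hε₀, hsub⟩ := mem_nhdsGT_iff_exists_Ioo_subset.1 hall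
  refine ⟨focusPert, h, fun i => (hbr i).1.trans (hmem i).1, hdisj h hmem, ε₀,
    fun ε i => returnLoop (-1 / 5) (-39 / 10) 1 ε (y i ε), hε₀, fun ε h0 h1 => ?_, fun i δ hδ => ?_⟩
  · have hε := hsub ⟨h0, h1⟩
    rw [perturbed_eq_spiralField]
    refine ⟨fun i j hij => ?_, fun i => ⟨(hε i).2.1, (hε i).2.2.1, (hε i).2.2.2.1⟩⟩
    dsimp only at hij
    have hm := left_mem_returnLoop (-1 / 5) (-39 / 10) 1 ε (y i ε)
    rw [hij] at hm
    exact hdisj (fun i => y i ε) (fun i => (hε i).1)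
      ((hε j).2.2.2.2 (y i ε) ((hbr i).1.trans (hε i).1.1) hm)
  · have hi0 : 0 < h i := (hbr i).1.trans (hmem i).1
    rw [← loopSet_zero_eq_annulusCurve hi0]
    obtain ⟨t1, t2, t3, -⟩ := tendsto_return (-1 / 5) (-39 / 10) 1 hi0 (hy i)
    exact eventually_hausdorffClose_loopSet (tendsto_mul_const_zero _) (tendsto_mul_const_zero _)
      (tendsto_mul_const_zero _) (hy i) t1 t2 t3 (hy i) hδ

end
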